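/- \textbf{The DG-UPW scheme for the convective Cahn--Hilliard equation preserves the maximum principle.} \emph{Setting.} Let $\Omega\subset\mathbb R^d$ ($d\ge 1$) be a bounded polygonal domain (connected, open, with $\overline\Omega$ a finite union of polytopes and $\Omega$ the interior of $\overline\Omega$), and let $\mathcal T_h$ be a conforming simplicial mesh of $\Omega$. Write $\mathcal E_h^i$ for the set of interior edges (faces if $d=3$), i.e. the $(d-1)$-dimensional faces $e$ shared by two elements $K\neq L$ of $\mathcal T_h$; for each of them fix the order of $K$ and $L$, let $\boldsymbol n_e$ be the unit normal to $e$ exterior to $K$ and pointing to $L$, and put $\{\!\{\boldsymbol\beta\}\!\}=\frac12(\boldsymbol\beta_K+\boldsymbol\beta_L)$ and $[\![\overline u]\!]=\overline u_K-\overline u_L$ on $e$. Let $\mathbb P_0^{\mathrm{disc}}(\mathcal T_h)$ be the space of functions that are constant on each element, and $\mathbb P_1^{\mathrm{cont}}(\mathcal T_h)$ the space of continuous functions on $\overline\Omega$ that are affine on each element. Let $T>0$, $N\geq 1$, $\Delta t=T/N$, $t_m=m\Delta t$, and $\varepsilon>0$. For $0<t\le T$ let $\boldsymbol v(t)\in C(\overline\Omega)^d$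 satisfy $\nabla\cdot\boldsymbol v(t)=0$ in $\Omega$ (in the sense of distributions) and $\boldsymbol v(t)\cdot\boldsymbol n=0$ on $\partial\Omega$ (at the points where $\partial\Omega$ is flat, $\boldsymbol n$ being the outward unit normal). For $a\in\mathbb R$ let $a_\oplus=\max\{a,0\}$ and $a_\ominus=-\min\{a,0\}$. Let $M(s)=s(1-s)$, $$M^\uparrow(s)=\begin{cases}M(s)_\oplus,& s\le\frac12\\ M(\frac12),& s>\frac12\end{cases},\qquad M^\downarrow(s)=\begin{cases}0,& s\le \frac12\\ M(s)_\oplus-M(\frac12),& s>\frac12\end{cases},$$ $$f(s,r)=\frac34 s+\frac14\begin{cases}-r,& r<0\\ 4r^3-6r^2-r,& 0\le r\le 1\\ -(r+2),& r>1\end{cases}.$$ For $u,\overline u\in\mathbb P_0^{\mathrm{disc}}(\mathcal T_h)$, for $\boldsymbol\beta$ continuous on each element, and for $\boldsymbol v\in C(\overline\Omega)^d$, put $$a_h^{\mathrm{upw}}(\boldsymbol\beta;M(u)_\oplus,\overline u)=-\sum_{K\in\mathcal T_h}\int_K(\boldsymbol\beta\cdot\nabla\overline u)M(u)_\oplus+\sum_{e\in\mathcal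 E_h^i,\,e=K\cap L}\int_e\Big((\{\!\{\boldsymbol\beta\}\!\}\cdot\boldsymbol n_e)_\oplus(M^\uparrow(u_K)+M^\downarrow(u_L))-(\{\!\{\boldsymbol\beta\}\!\}\cdot\boldsymbol n_e)_\ominus(M^\uparrow(u_L)+M^\downarrow(u_K))\Big)[\![\overline u]\!],$$ $$a_h^{\mathrm{upw}}(\boldsymbol v;u,\overline u)=\sum_{e\in\mathcal E_h^i,\,e=K\cap L}\int_e\big((\boldsymbol v\cdot\boldsymbol n_e)_\oplus u_K-(\boldsymbol v\cdot\boldsymbol n_e)_\ominus u_L\big)[\![\overline u]\!].$$ \emph{Scheme (DG-UPW).} Let $0\le m<N$. Given $u^m\in\mathbb P_0^{\mathrm{disc}}(\mathcal T_h)$, a solution consists of $u^{m+1}\in\mathbb P_0^{\mathrm{disc}}(\mathcal T_h)$ and $\mu^{m+1},w^{m+1}\in\mathbb P_1^{\mathrm{cont}}(\mathcal T_h)$ such that, with $(\cdot,\cdot)$ the $L^2(\Omega)$ product, $$\Big(\frac{u^{m+1}-u^m}{\Delta t},\overline u\Big)+a_h^{\mathrm{upw}}(-\nabla\mu^{m+1};M(u^{m+1})_\oplus,\overline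 u)+a_h^{\mathrm{upw}}(\boldsymbol v(t_{m+1});u^{m+1},\overline u)=0,$$ $$(\mu^{m+1},\overline\mu)=\varepsilon^2(\nabla w^{m+1},\nabla\overline\mu)+(f(u^{m+1},u^m),\overline\mu),\qquad (w^{m+1},\overline w)=(u^{m+1},\overline w)$$ for all $\overline u\in\mathbb P_0^{\mathrm{disc}}(\mathcal T_h)$ and all $\overline\mu,\overline w\in\mathbb P_1^{\mathrm{cont}}(\mathcal T_h)$. \emph{Theorem.} For every $u^m\in\mathbb P_0^{\mathrm{disc}}(\mathcal T_h)$ with $0\le u^m\le 1$ on every element, every solution $(u^{m+1},\mu^{m+1},w^{m+1})$ of the scheme satisfies $0\le u^{m+1}\le 1$ on every element. -/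

import Mathlib

open MeasureTheory Topology
open scoped RealInnerProductSpace Gradient

noncomputable section

namespace DGUPW

/-- The ambient space `ℝ^d` with its Euclidean norm. -/
abbrev Space (d : ℕ) : Type := EuclideanSpace ℝ (Fin d)

/-! ### Domain and velocity -/

/-- A bounded polygonal (polyhedral) domain of `ℝ^d`: a connected open set whose closure is a finite
union of convex hulls of finite sets, and which has no slits (it is the interior of its closure). -/
structure IsPolygonalDomain {d : ℕ} (Ω : Set (Space d)) : Prop where
  isOpen : IsOpen Ω
  isConnected : IsConnected Ω
  closure_eq : ∃ P : Finset (Finset (Space d)),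
    closure Ω = ⋃ s ∈ P, convexHull ℝ (s : Set (Space d))
  interior_closure : interior (closure Ω) = Ω

/-- `n` is the outward unit normal of `Ω` at `x`, where `x` is a flat point of the boundary: near
`x`, the set `Ω` is the open half-space `{y | ⟪n, y - x⟫ < 0}`. -/
def IsOutwardNormalAt {d : ℕ} (Ω : Set (Space d)) (x n : Space d) : Prop :=
  ‖n‖ = 1 ∧ ∀ᶠ y in 𝓝 x, (y ∈ Ω ↔ ⟪n, y - x⟫ < 0)

/-- `∇ ⬝ v = 0` in `Ω` in the sense of distributions. -/
def IsDivFree {d : ℕ} (Ω : Set (Space d)) (v : Space d → Space d) : Prop :=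
  ∀ φ : Space d → ℝ, ContDiff ℝ (⊤ : ℕ∞) φ → HasCompactSupport φ → tsupport φ ⊆ Ω →
    ∫ x in Ω, ⟪v x, ∇ φ x⟫ = 0

/-- A continuous incompressible velocity field on the closure of `Ω` with the slip condition
`v ⬝ n = 0` on the boundary of `Ω`. -/
structure IsIncompressibleVelocity {d : ℕ} (Ω : Set (Space d)) (v : Space d → Space d) : Prop where
  continuousOn : ContinuousOn v (closure Ω)
  divFree : IsDivFree Ω v
  slip : ∀ x n, IsOutwardNormalAt Ω x n → ⟪v x, n⟫ = 0

/-! ### Meshes -/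

/-- A (conforming) simplicial mesh of `Ω`: a finite simplicial complex covering the closure of `Ω`,
in which each face lies in a face of dimension `d`. Faces are given by their sets of vertices. -/
structure Mesh {d : ℕ} (Ω : Set (Space d)) where
  complex : Geometry.SimplicialComplex ℝ (Space d)
  finite : complex.faces.Finite
  pure : ∀ s ∈ complex.faces, ∃ t ∈ complex.faces, s ⊆ t ∧ t.card = d + 1
  space_eq : complex.space = closure Ω

variable {d : ℕ} {Ω : Set (Space d)}

/-- The elements of the mesh: its `d`-simplices. -/
def Mesh.Elem (𝒯 : Mesh Ω) : Type :=
  {K : Finset (Space d) // K ∈ 𝒯.complex.faces ∧ K.card = d + 1}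

/-- The interior edges (faces if `d = 3`): the `(d-1)`-simplices shared by two elements. -/
def Mesh.IntEdge (𝒯 : Mesh Ω) : Type :=
  {e : Finset (Space d) // e ∈ 𝒯.complex.faces ∧ e.card = d ∧
    ∃ K L : 𝒯.Elem, K ≠ L ∧ e ⊆ K.1 ∧ e ⊆ L.1}

instance Mesh.instFintypeElem (𝒯 : Mesh Ω) : Fintype 𝒯.Elem :=
  (𝒯.finite.subset (t := {K | K ∈ 𝒯.complex.faces ∧ K.card = d + 1}) fun _ h => h.1).fintype

instance Mesh.instFintypeIntEdge (𝒯 : Mesh Ω) : Fintype 𝒯.IntEdge :=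
  (𝒯.finite.subset (t := {e | e ∈ 𝒯.complex.faces ∧ e.card = d ∧
    ∃ K L : 𝒯.Elem, K ≠ L ∧ e ⊆ K.1 ∧ e ⊆ L.1}) fun _ h => h.1).fintype

/-- The closed simplex with the vertices of the element `K`. -/
def Mesh.Elem.carrier {𝒯 : Mesh Ω} (K : 𝒯.Elem) : Set (Space d) :=
  convexHull ℝ (K.1 : Set (Space d))

/-- The closed simplex with the vertices of the edge `e`. -/
def Mesh.IntEdge.carrier {𝒯 : Mesh Ω} (e : 𝒯.IntEdge) : Set (Space d) :=
  convexHull ℝ (e.1 : Set (Space d))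

/-- The unit normal to the facet with vertices `e` of the simplex with vertices `K`, exterior to the
simplex: the normalized component, orthogonal to the facet, of the vector from the centroid of the
simplex to the centroid of the facet. -/
def outerNormal (K e : Finset (Space d)) : Space d :=
  let a := (vectorSpan ℝ (e : Set (Space d)))ᗮ.starProjection
    (e.centroid ℝ id - K.centroid ℝ id)
  ‖a‖⁻¹ • a

/-- A choice, for each interior edge `e = K ∩ L`, of which of its two elements is called `K` (here
`left e`) and which `L` (here `right e`). -/
structure Mesh.Orientation (𝒯 : Mesh Ω) where
  left : 𝒯.IntEdge → 𝒯.Elem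
  right : 𝒯.IntEdge → 𝒯.Elem
  ne : ∀ e, left e ≠ right e
  subset_left : ∀ e, e.1 ⊆ (left e).1
  subset_right : ∀ e, e.1 ⊆ (right e).1

/-- The unit normal `n_e`, exterior to `K = left e` and pointing to `L = right e`. -/
def Mesh.Orientation.normal {𝒯 : Mesh Ω} (o : 𝒯.Orientation) (e : 𝒯.IntEdge) : Space d :=
  outerNormal (o.left e).1 e.1

/-! ### Discrete spaces -/

/-- The discontinuous piecewise constants: one value per element. -/
abbrev Mesh.P0disc (𝒯 : Mesh Ω) : Type := 𝒯.Elem → ℝ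

/-- The continuous functions on the closure of `Ω` that agree on each element `K` with an affine
function `piece K`. -/
structure Mesh.P1cont (𝒯 : Mesh Ω) where
  toFun : Space d → ℝ
  continuousOn : ContinuousOn toFun (closure Ω)
  piece : 𝒯.Elem → (Space d →ᵃ[ℝ] ℝ)
  eqOn : ∀ K : 𝒯.Elem, Set.EqOn toFun (piece K) K.carrier

/-- A piecewise constant function as a function given element by element. -/
def Mesh.P0disc.broken {𝒯 : Mesh Ω} (u : 𝒯.P0disc) : 𝒯.Elem → Space d → ℝ := fun K _ => u K

/-- A continuous piecewise affine function as a function given element by element. -/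
def Mesh.P1cont.broken {𝒯 : Mesh Ω} (p : 𝒯.P1cont) : 𝒯.Elem → Space d → ℝ := fun _ x => p.toFun x

/-- The elementwise gradient of a continuous piecewise affine function. -/
def Mesh.P1cont.grad {𝒯 : Mesh Ω} (p : 𝒯.P1cont) : 𝒯.Elem → Space d → Space d :=
  fun K x => ∇ (fun y => p.piece K y) x

/-- The `L²(Ω)` product of functions given element by element. -/
def Mesh.inner₂ (𝒯 : Mesh Ω) (f g : 𝒯.Elem → Space d → ℝ) : ℝ :=
  ∑ K, ∫ x in K.carrier, f K x * g K x

/-- The `L²(Ω)^d` product of vector fields given element by element. -/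
def Mesh.vinner₂ (𝒯 : Mesh Ω) (f g : 𝒯.Elem → Space d → Space d) : ℝ :=
  ∑ K, ∫ x in K.carrier, ⟪f K x, g K x⟫

/-- The surface integral over an interior edge (the integral over a point if `d = 1`). -/
def Mesh.edgeIntegral {𝒯 : Mesh Ω} (e : 𝒯.IntEdge) (g : Space d → ℝ) : ℝ :=
  ∫ x in e.carrier, g x ∂(Measure.euclideanHausdorffMeasure (d - 1))

/-! ### Mobility and potential -/

/-- The positive part `a_⊕`. -/
def posPart (a : ℝ) : ℝ := max a 0

/-- The negative part `a_⊖ = -min(a, 0)`. -/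
def negPart (a : ℝ) : ℝ := -min a 0

/-- The degenerate mobility `M(u) = u (1 - u)`. -/
def mobility (u : ℝ) : ℝ := u * (1 - u)

/-- The increasing part `M↑` of `M_⊕`. -/
def mobilityUp (u : ℝ) : ℝ :=
  if u ≤ 1 / 2 then posPart (mobility u) else mobility (1 / 2)

/-- The decreasing part `M↓` of `M_⊕`. -/
def mobilityDown (u : ℝ) : ℝ :=
  if u ≤ 1 / 2 then 0 else posPart (mobility u) - mobility (1 / 2)

/-- The convex-implicit, concave-explicit approximation `f(u₁, u₀) = F_i'(u₁) + F_e'(u₀)` of the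
derivative of the truncated Ginzburg-Landau potential. -/
def potentialTerm (u₁ u₀ : ℝ) : ℝ :=
  3 / 4 * u₁ + 1 / 4 *
    (if u₀ < 0 then -u₀
     else if u₀ ≤ 1 then 4 * u₀ ^ 3 - 6 * u₀ ^ 2 - u₀
     else -(u₀ + 2))

/-! ### Upwind forms and the scheme -/

/-- The generalized upwind form `a_h^upw(β; M(u)_⊕, ū)`, for a field `β` which may be discontinuous
across the edges. -/
def upwMobility {𝒯 : Mesh Ω} (o : 𝒯.Orientation) (β : 𝒯.Elem → Space d → Space d)
    (u ub : 𝒯.P0disc) : ℝ :=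
  -(∑ K, ∫ x in K.carrier, ⟪β K x, ∇ (ub.broken K) x⟫ * posPart (mobility (u K))) +
  ∑ e, Mesh.edgeIntegral e fun x =>
    let K := o.left e
    let L := o.right e
    let b := ⟪(1 / 2 : ℝ) • (β K x + β L x), o.normal e⟫
    (posPart b * (mobilityUp (u K) + mobilityDown (u L))
      - negPart b * (mobilityUp (u L) + mobilityDown (u K))) * (ub K - ub L)

/-- The upwind form `a_h^upw(v; u, ū)` for the linear convection by a continuous field `v`. -/
def upwLinear {𝒯 : Mesh Ω} (o : 𝒯.Orientation) (v : Space d → Space d)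
    (u ub : 𝒯.P0disc) : ℝ :=
  ∑ e, Mesh.edgeIntegral e fun x =>
    let K := o.left e
    let L := o.right e
    let b := ⟪v x, o.normal e⟫
    (posPart b * u K - negPart b * u L) * (ub K - ub L)

/-- `(u, μ, w)` solves one step, of length `Δt` and from the datum `u₀`, of the fully discrete
DG-UPW scheme, where `v` is the velocity at the new time. -/
structure IsSolution {𝒯 : Mesh Ω} (o : 𝒯.Orientation) (ε Δt : ℝ) (v : Space d → Space d)
    (u₀ u : 𝒯.P0disc) (μ w : 𝒯.P1cont) : Prop where
  phase : ∀ ub : 𝒯.P0disc,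
    𝒯.inner₂ (fun K _ => (u K - u₀ K) / Δt) ub.broken
      + upwMobility o (fun K x => -(μ.grad K x)) u ub + upwLinear o v u ub = 0
  potential : ∀ μb : 𝒯.P1cont,
    𝒯.inner₂ μ.broken μb.broken
      = ε ^ 2 * 𝒯.vinner₂ w.grad μb.grad
        + 𝒯.inner₂ (fun K _ => potentialTerm (u K) (u₀ K)) μb.broken
  regularized : ∀ wb : 𝒯.P1cont,
    𝒯.inner₂ w.broken wb.broken = 𝒯.inner₂ u.broken wb.broken

end DGUPW

end

namespace DGUPW

open Filter

/-! ### Integration in the direction of a unit vector -/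

section Slab

variable {d : ℕ}

/-! Let `K` be an element where `u` is minimal, suppose `u K < 0`, and test the phase equation with
the indicator of `K`. The time term is negative because the old value is at least `0`. The mobility
form is nonpositive for any `μ`: both monotone parts of the mobility vanish at `u K`, and what the
neighbours contribute has a sign (`upwMobility_nonpos`). The convective form is nonpositive too
(`upwLinear_nonpos`): replacing each neighbouring value by the smaller `u K` can only increase it,
and turns it into `u K` times the total flux of `v` through the interior edges of `K`, which is
zero. So the three terms cannot add up to zero. The upper bound is the mirror argument at a maximum,
where the monotone parts take their extreme values `± M(1/2)`.

The work lies in the vanishing of that flux, since `v` is merely continuous and divergence-free as a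
distribution. On a simplex with barycentric coordinates `λ_j`, test the divergence with `∏ η(c
λ_j)`, where `η` is a smooth step. As `c → ∞` the gradient concentrates on the facets, and the part
with `η'(c λ_i)` converges to `‖∇λ_i‖⁻¹` times the integral of `⟪v, ∇λ_i⟫` over facet `i`
(`tendsto_facet`). This gives the divergence theorem `sum_facet_flux_eq_zero`. A facet that lies in
no other element consists, up to a null set, of flat boundary points, so the slip condition kills
its flux. Conformity gives every other facet exactly two elements, with opposite outer normals. The
sum over interior edges is therefore the full outward flux (`sum_edgeIntegral_eq_zero`). -/

lemma measurePreserving_slab {u : Space d} (hu : ‖u‖ = 1) (p : Space d) :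
    MeasurePreserving (((LinearIsometryEquiv.toSpanUnitSingleton (𝕜 := ℝ) u hu
        ).toHomeomorph.toMeasurableEquiv.prodCongr (MeasurableEquiv.refl (ℝ ∙ u)ᗮ)).trans
          ((ℝ ∙ u).measurableEquivProd p).symm) := by
  have h1 := (ℝ ∙ u).measurePreserving_measurableEquivProd p
  rw [finrank_euclideanSpace_fin, EuclideanSpace.euclideanHausdorffMeasure_eq_volume] at h1
  refine MeasurePreserving.trans ?_ h1.symm
  exact (LinearIsometryEquiv.toSpanUnitSingleton (𝕜 := ℝ) u hu).measurePreserving.prod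
    (MeasurePreserving.id _)

/-- Integration over the space in terms of a rescaled coordinate along the unit vector `u` and of
the orthogonal coordinates. -/
lemma integral_slab {u : Space d} (hu : ‖u‖ = 1) (p : Space d) {c : ℝ} (hc : c ≠ 0)
    (f : Space d → ℝ) :
    ∫ z : ℝ × (ℝ ∙ u)ᗮ, f (p + ((c * z.1) • u + (z.2 : Space d))) = |c⁻¹| * ∫ x, f x := by
  have h1 := (measurePreserving_slab hu p).integral_comp' f
  have h2 : ∀ z : ℝ × (ℝ ∙ u)ᗮ, (((LinearIsometryEquiv.toSpanUnitSingleton (𝕜 := ℝ) u hu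
        ).toHomeomorph.toMeasurableEquiv.prodCongr (MeasurableEquiv.refl (ℝ ∙ u)ᗮ)).trans
          ((ℝ ∙ u).measurableEquivProd p).symm) z = p + (z.1 • u + (z.2 : Space d)) := by
    intro z
    simp [MeasurableEquiv.prodCongr, add_comm]
  simp only [h2] at h1
  rw [← h1]
  have h3 : Measure.map ((Homeomorph.mulLeft₀ c hc).toMeasurableEquiv.prodCongr
      (MeasurableEquiv.refl (ℝ ∙ u)ᗮ)) (volume : Measure (ℝ × (ℝ ∙ u)ᗮ)) =
      ENNReal.ofReal |c⁻¹| • (volume : Measure (ℝ × (ℝ ∙ u)ᗮ)) := by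
    have := Measure.map_prod_map (f := fun x : ℝ => c * x) (g := (id : (ℝ ∙ u)ᗮ → (ℝ ∙ u)ᗮ))
      volume volume (by fun_prop) measurable_id
    rw [Real.map_volume_mul_left hc, Measure.map_id, Measure.prod_smul_left] at this
    exact this.symm
  have h4 := integral_map_equiv (μ := (volume : Measure (ℝ × (ℝ ∙ u)ᗮ)))
    ((Homeomorph.mulLeft₀ c hc).toMeasurableEquiv.prodCongr
      (MeasurableEquiv.refl (ℝ ∙ u)ᗮ)) (fun z => f (p + (z.1 • u + (z.2 : Space d))))
  rw [h3, integral_smul_measure, ENNReal.toReal_ofReal (abs_nonneg _), smul_eq_mul] at h4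
  rw [h4]
  rfl

variable {u : Space d}

/-! ### Surface measure on a hyperplane -/

lemma isometry_hyperplane (u p : Space d) :
    Isometry fun y : (ℝ ∙ u)ᗮ => p + (y : Space d) :=
  (IsometryEquiv.addLeft p).isometry.comp isometry_subtype_coe

lemma range_hyperplane (u p : Space d) :
    Set.range (fun y : (ℝ ∙ u)ᗮ => p + (y : Space d)) = {x | ⟪u, x - p⟫ = 0} := by
  ext x
  constructor
  · rintro ⟨y, rfl⟩
    simpa using Submodule.mem_orthogonal_singleton_iff_inner_right.1 y.2
  · intro hx
    exact ⟨⟨x - p, Submodule.mem_orthogonal_singleton_iff_inner_right.2 hx⟩, by simp⟩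

lemma finrank_orthogonal_span_unit (hu : u ≠ 0) :
    Module.finrank ℝ (ℝ ∙ u)ᗮ = d - 1 := by
  have h := (ℝ ∙ u).finrank_add_finrank_orthogonal
  rw [finrank_span_singleton hu, finrank_euclideanSpace_fin] at h
  omega

lemma map_hyperplane (hu : u ≠ 0) (p : Space d) :
    Measure.map (fun y : (ℝ ∙ u)ᗮ => p + (y : Space d)) volume =
      (Measure.euclideanHausdorffMeasure (d - 1)).restrict {x | ⟪u, x - p⟫ = 0} := by
  rw [← range_hyperplane, ← (isometry_hyperplane u p).map_euclideanHausdorffMeasure,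
    ← finrank_orthogonal_span_unit hu, InnerProductSpace.euclideanHausdorffMeasure_eq_volume]

lemma measurableEmbedding_hyperplane (u p : Space d) :
    MeasurableEmbedding fun y : (ℝ ∙ u)ᗮ => p + (y : Space d) :=
  (isometry_hyperplane u p).isClosedEmbedding.measurableEmbedding

/-- The surface integral over a measurable subset of a hyperplane. -/
lemma integral_hyperplane (hu : u ≠ 0) (p : Space d) {F : Set (Space d)} (hF : MeasurableSet F)
    (hFp : F ⊆ {x | ⟪u, x - p⟫ = 0}) (f : Space d → ℝ) :
    ∫ x in F, f x ∂(Measure.euclideanHausdorffMeasure (d - 1)) =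
      ∫ y : (ℝ ∙ u)ᗮ, F.indicator f (p + (y : Space d)) := by
  rw [← (measurableEmbedding_hyperplane u p).integral_map (F.indicator f), map_hyperplane hu,
    integral_indicator hF, Measure.restrict_restrict hF, Set.inter_eq_left.2 hFp]

/-- Measurability of the hyperplane suffices, so `F` may be any subset of it, such as the
exceptional set in `ae_facet`. -/
lemma measure_hyperplane (hu : u ≠ 0) (p : Space d) {F : Set (Space d)}
    (hFp : F ⊆ {x | ⟪u, x - p⟫ = 0}) :
    Measure.euclideanHausdorffMeasure (d - 1) F =
      volume ((fun y : (ℝ ∙ u)ᗮ => p + (y : Space d)) ⁻¹' F) := by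
  rw [← (measurableEmbedding_hyperplane u p).map_apply, map_hyperplane hu, Measure.restrict_apply',
    Set.inter_eq_left.2 hFp]
  exact measurableSet_eq_fun (by fun_prop) measurable_const

/-- An affine function that does not vanish identically on a hyperplane is almost everywhere nonzero
there. -/
lemma ae_hyperplane_ne_zero (p : Space d) (l : Space d →ᵃ[ℝ] ℝ)
    (hl : ∃ y : (ℝ ∙ u)ᗮ, l (p + (y : Space d)) ≠ 0) :
    ∀ᵐ y : (ℝ ∙ u)ᗮ, l (p + (y : Space d)) ≠ 0 := by
  let l' : (ℝ ∙ u)ᗮ →ᵃ[ℝ] ℝ :=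
    l.comp ((AffineEquiv.constVAdd ℝ (Space d) p).toAffineMap.comp
      ((ℝ ∙ u)ᗮ.subtype.toAffineMap))
  have h := Measure.addHaar_affineSubspace (volume : Measure (ℝ ∙ u)ᗮ)
    ((AffineSubspace.mk' (0 : ℝ) ⊥).comap l') (by
      intro h
      obtain ⟨y, hy⟩ := hl
      have : y ∈ ((AffineSubspace.mk' (0 : ℝ) ⊥).comap l') := by rw [h]; trivial
      apply hy
      simpa [l'] using this)
  rw [ae_iff]
  convert h using 2
  ext y
  simp [l']

end Slab

/-! ### A smooth cutoff function on the line -/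

/-- A smooth function which is `0` on `(-∞, 1]` and `1` on `[2, ∞)`. -/
noncomputable def cutoff (t : ℝ) : ℝ := Real.smoothTransition (t - 1)

lemma contDiff_cutoff : ContDiff ℝ (⊤ : ℕ∞) cutoff :=
  Real.smoothTransition.contDiff.comp (contDiff_id.sub contDiff_const)

lemma cutoff_of_le_one {t : ℝ} (ht : t ≤ 1) : cutoff t = 0 :=
  Real.smoothTransition.zero_of_nonpos (by linarith)

lemma cutoff_of_two_le {t : ℝ} (ht : 2 ≤ t) : cutoff t = 1 :=
  Real.smoothTransition.one_of_one_le (by linarith)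

lemma abs_cutoff_le_one (t : ℝ) : |cutoff t| ≤ 1 := by
  rw [cutoff, abs_of_nonneg (Real.smoothTransition.nonneg _)]
  exact Real.smoothTransition.le_one _

lemma hasDerivAt_cutoff (t : ℝ) : HasDerivAt cutoff (deriv cutoff t) t :=
  (contDiff_cutoff.differentiable (by simp) t).hasDerivAt

lemma continuous_deriv_cutoff : Continuous (deriv cutoff) :=
  contDiff_cutoff.continuous_deriv (by exact_mod_cast le_top)

lemma deriv_cutoff_eq_zero {t : ℝ} (ht : t < 1 ∨ 2 < t) : deriv cutoff t = 0 := by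
  rcases ht with ht | ht
  · have : cutoff =ᶠ[𝓝 t] fun _ => 0 := by
      filter_upwards [Iio_mem_nhds ht] with s hs using cutoff_of_le_one (le_of_lt hs)
    rw [this.deriv_eq, deriv_const]
  · have : cutoff =ᶠ[𝓝 t] fun _ => 1 := by
      filter_upwards [Ioi_mem_nhds ht] with s hs using cutoff_of_two_le (le_of_lt hs)
    rw [this.deriv_eq, deriv_const]

lemma hasCompactSupport_deriv_cutoff : HasCompactSupport (deriv cutoff) := by
  refine HasCompactSupport.intro (isCompact_Icc (a := (1 : ℝ)) (b := 2)) fun t ht => ?_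
  apply deriv_cutoff_eq_zero
  by_contra! h
  exact ht h

lemma exists_bound_deriv_cutoff : ∃ C, ∀ t, |deriv cutoff t| ≤ C :=
  hasCompactSupport_deriv_cutoff.exists_bound_of_continuous continuous_deriv_cutoff

/-- The unit mass of `η'` is what makes the limit in `tendsto_facet` independent of the choice of
`η`. -/
lemma integral_deriv_cutoff : ∫ t, deriv cutoff t = 1 := by
  have h := integral_of_hasDerivAt_of_tendsto hasDerivAt_cutoff
    (continuous_deriv_cutoff.integrable_of_hasCompactSupport hasCompactSupport_deriv_cutoff)
    (m := 0) (n := 1) (tendsto_const_nhds.congr' ?_) (tendsto_const_nhds.congr' ?_)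
  · simpa using h
  · filter_upwards [eventually_le_atBot 1] with t ht using (cutoff_of_le_one ht).symm
  · filter_upwards [eventually_ge_atTop 2] with t ht using (cutoff_of_two_le ht).symm

/-! ### Barycentric coordinates -/

section Coord

variable {d : ℕ} {ι : Type*} (b : AffineBasis ι ℝ (Space d))

/-- The gradient of a barycentric coordinate. -/
noncomputable def coordGrad (i : ι) : Space d :=
  (InnerProductSpace.toDual ℝ (Space d)).symm (LinearMap.toContinuousLinearMap (b.coord i).linear)

lemma inner_coordGrad (i : ι) (z : Space d) : ⟪coordGrad b i, z⟫ = (b.coord i).linear z := by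
  simp [coordGrad]

lemma coord_add (i : ι) (x z : Space d) :
    b.coord i (x + z) = b.coord i x + ⟪coordGrad b i, z⟫ := by
  rw [inner_coordGrad, add_comm x z, ← vadd_eq_add, (b.coord i).map_vadd, vadd_eq_add, add_comm]

lemma coord_eq_add_inner (i : ι) (x y : Space d) :
    b.coord i y = b.coord i x + ⟪coordGrad b i, y - x⟫ := by
  rw [← coord_add, add_sub_cancel]

lemma continuous_coord (i : ι) : Continuous (b.coord i) :=
  AffineMap.continuous_of_finiteDimensional _

lemma coordGrad_ne_zero [Nontrivial ι] (i : ι) : coordGrad b i ≠ 0 := by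
  intro h
  obtain ⟨j, hj⟩ := exists_ne i
  have := coord_eq_add_inner b i (b j) (b i)
  rw [h, inner_zero_left, b.coord_apply_eq, b.coord_apply_ne hj.symm] at this
  norm_num at this

lemma hasFDerivAt_coord (i : ι) (x : Space d) :
    HasFDerivAt (b.coord i) (innerSL ℝ (coordGrad b i)) x := by
  have h : HasFDerivAt (fun y => b.coord i 0 + innerSL ℝ (coordGrad b i) y)
      (innerSL ℝ (coordGrad b i)) x :=
    ((innerSL ℝ (coordGrad b i)).hasFDerivAt).const_add _
  convert! h using 1
  ext y
  simpa using coord_add b i 0 y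

lemma contDiff_coord {n : WithTop ℕ∞} (i : ι) : ContDiff ℝ n (b.coord i) := by
  have h : ContDiff ℝ n (fun y => b.coord i 0 + innerSL ℝ (coordGrad b i) y) :=
    contDiff_const.add (innerSL ℝ (coordGrad b i)).contDiff
  convert! h using 1
  ext y
  simpa using coord_add b i 0 y

/-- The closed facet of the simplex opposite to the vertex `i`. -/
def facet (i : ι) : Set (Space d) := {x | b.coord i x = 0 ∧ ∀ j, 0 ≤ b.coord j x}

lemma isClosed_facet (i : ι) : IsClosed (facet b i) := by
  have h : facet b i = {x | b.coord i x = 0} ∩ ⋂ j, {x | 0 ≤ b.coord j x} := by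
    ext x
    simp [facet]
  rw [h]
  exact (isClosed_eq (continuous_coord b i) continuous_const).inter
    (isClosed_iInter fun j => isClosed_le continuous_const (continuous_coord b j))

lemma mem_simplex {x : Space d} :
    x ∈ convexHull ℝ (Set.range b) ↔ ∀ j, 0 ≤ b.coord j x := by
  rw [b.convexHull_eq_nonneg_coord]; rfl

lemma facet_subset_simplex (i : ι) : facet b i ⊆ convexHull ℝ (Set.range b) :=
  fun _ hx => (mem_simplex b).2 hx.2

lemma isCompact_simplex [Finite ι] : IsCompact (convexHull ℝ (Set.range b)) :=
  (Set.finite_range b).isCompact_convexHull ℝ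

/-! ### Test functions supported inside a simplex -/

variable [Fintype ι]

/-- The test function `∏ η(c λ_j)` built on the cutoff `η` and the barycentric coordinates. -/
noncomputable def bump (c : ℝ) (x : Space d) : ℝ := ∏ j, cutoff (c * b.coord j x)

lemma contDiff_bump (c : ℝ) : ContDiff ℝ (⊤ : ℕ∞) (bump b c) :=
  contDiff_prod fun j _ => contDiff_cutoff.comp (contDiff_const.mul (contDiff_coord b j))

lemma tsupport_bump_subset {c : ℝ} (hc : 0 < c) :
    tsupport (bump b c) ⊆ {x | ∀ j, 0 < b.coord j x} := by
  -- The step starts at `1` rather than `0`, so the support lies in a closed set that stays away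
  -- from the facets.
  have h : tsupport (bump b c) ⊆ {x | ∀ j, 1 ≤ c * b.coord j x} := by
    refine closure_minimal (fun x hx j => ?_) ?_
    · by_contra! hj
      exact hx (Finset.prod_eq_zero (Finset.mem_univ j) (cutoff_of_le_one hj.le))
    · simp only [Set.ofPred_forall]
      exact isClosed_iInter fun j =>
        isClosed_le continuous_const (continuous_const.mul (continuous_coord b j))
  intro x hx j
  have := h hx j
  by_contra! hj
  nlinarith [mul_nonneg hc.le (neg_nonneg.2 hj)]

lemma hasCompactSupport_bump {c : ℝ} (hc : 0 < c) : HasCompactSupport (bump b c) :=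
  (isCompact_simplex b).of_isClosed_subset (isClosed_tsupport _) fun _ hx =>
    (mem_simplex b).2 fun j => (tsupport_bump_subset b hc hx j).le

variable [DecidableEq ι]

/-- The product rule splits the gradient by facets: the term with `η'(c λ_i)` lives in a layer of
width of order `1 / c` along facet `i`. -/
lemma inner_gradient_bump (c : ℝ) (x z : Space d) :
    ⟪z, ∇ (bump b c) x⟫ = ∑ i, c * (deriv cutoff (c * b.coord i x) *
      ((∏ j ∈ Finset.univ.erase i, cutoff (c * b.coord j x)) * ⟪z, coordGrad b i⟫)) := by
  have h : HasFDerivAt (bump b c) (∑ i, (∏ j ∈ Finset.univ.erase i, cutoff (c * b.coord j x)) •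
      (deriv cutoff (c * b.coord i x) • (c • innerSL ℝ (coordGrad b i)))) x := by
    refine HasFDerivAt.finsetProd fun i _ => ?_
    exact (hasDerivAt_cutoff _).comp_hasFDerivAt x ((hasFDerivAt_coord b i x).const_mul c)
  rw [gradient, real_inner_comm, InnerProductSpace.toDual_symm_apply, h.fderiv,
    sum_apply]
  refine Finset.sum_congr rfl fun i _ => ?_
  simp only [smul_apply, innerSL_apply_apply, smul_eq_mul,
    real_inner_comm z (coordGrad b i)]
  ring

end Coord

/-! ### The divergence theorem on a simplex -/

section Flux

variable {d : ℕ} {ι : Type*} (b : AffineBasis ι ℝ (Space d))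

lemma norm_unit_coordGrad [Nontrivial ι] (i : ι) : ‖‖coordGrad b i‖⁻¹ • coordGrad b i‖ = 1 := by
  rw [norm_smul, norm_inv, norm_norm, inv_mul_cancel₀ (norm_ne_zero_iff.2 (coordGrad_ne_zero b i))]

lemma inner_coordGrad_unit [Nontrivial ι] (i : ι) :
    ⟪coordGrad b i, ‖coordGrad b i‖⁻¹ • coordGrad b i⟫ = ‖coordGrad b i‖ := by
  have := norm_ne_zero_iff.2 (coordGrad_ne_zero b i)
  rw [inner_smul_right, real_inner_self_eq_norm_sq]
  field_simp

lemma unit_coordGrad_ne_zero [Nontrivial ι] (i : ι) : ‖coordGrad b i‖⁻¹ • coordGrad b i ≠ 0 := by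
  rw [← norm_ne_zero_iff, norm_unit_coordGrad]; exact one_ne_zero

lemma facet_subset_hyperplane {i j : ι} (hij : j ≠ i) :
    facet b i ⊆ {x | ⟪‖coordGrad b i‖⁻¹ • coordGrad b i, x - b j⟫ = 0} := by
  intro x hx
  have h := coord_eq_add_inner b i (b j) x
  rw [hx.1, b.coord_apply_ne hij.symm, zero_add] at h
  simp [inner_smul_left, ← h]

lemma coord_hyperplane {i j : ι} (hij : j ≠ i) (c : ℝ)
    (z : (ℝ ∙ (‖coordGrad b i‖⁻¹ • coordGrad b i))ᗮ) [Nontrivial ι] :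
    b.coord i (b j + (c • (‖coordGrad b i‖⁻¹ • coordGrad b i) + (z : Space d))) =
      c * ‖coordGrad b i‖ := by
  have hz : ⟪coordGrad b i, (z : Space d)⟫ = 0 := by
    have := Submodule.mem_orthogonal_singleton_iff_inner_right.1 z.2
    rw [inner_smul_left] at this
    refine (mul_eq_zero.1 this).resolve_left ?_
    simpa using coordGrad_ne_zero b i
  rw [coord_add, b.coord_apply_ne hij.symm, inner_add_right, hz, inner_smul_right,
    inner_coordGrad_unit]
  ring

/-- The vertex `b k` lies on the hyperplane of facet `i` and has `k`-th coordinate `1`. So the zero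
set of that coordinate is a proper affine subspace of the hyperplane, hence null. -/
lemma ae_coord_ne_zero [Nontrivial ι] [Finite ι] {i j : ι} (hij : j ≠ i) :
    ∀ᵐ y : (ℝ ∙ (‖coordGrad b i‖⁻¹ • coordGrad b i))ᗮ, ∀ k, k ≠ i →
      b.coord k (b j + (y : Space d)) ≠ 0 := by
  rw [ae_all_iff]
  intro k
  by_cases hk : k = i
  · simp [hk]
  · have hmem : b k ∈ facet b i :=
      ⟨b.coord_apply_ne (Ne.symm hk), fun l => by
        classical
        rw [b.coord_apply]; split_ifs <;> norm_num⟩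
    have hk' : b k ∈ Set.range
        fun y : (ℝ ∙ (‖coordGrad b i‖⁻¹ • coordGrad b i))ᗮ => b j + (y : Space d) := by
      rw [range_hyperplane]; exact facet_subset_hyperplane b hij hmem
    obtain ⟨y, hy⟩ := hk'
    filter_upwards [ae_hyperplane_ne_zero (b j) (b.coord k) ⟨y, by
      simp only at hy
      rw [hy, b.coord_apply_eq]; exact one_ne_zero⟩] with y hy _ using hy

/-- Almost every point of a facet is in its relative interior. -/
lemma ae_facet [Nontrivial ι] [Finite ι] (i : ι) :
    ∀ᵐ x ∂(Measure.euclideanHausdorffMeasure (d - 1)).restrict (facet b i),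
      b.coord i x = 0 ∧ ∀ k, k ≠ i → 0 < b.coord k x := by
  obtain ⟨j, hj⟩ := exists_ne i
  rw [ae_restrict_iff' (isClosed_facet b i).measurableSet, ae_iff]
  rw [measure_hyperplane (unit_coordGrad_ne_zero b i) (b j)]
  · refine measure_mono_null (fun y hy => ?_) (ae_coord_ne_zero b hj)
    intro hne
    refine hy fun hx => ⟨hx.1, fun k hk => lt_of_le_of_ne (hx.2 k) (hne k hk).symm⟩
  · intro x hx
    refine facet_subset_hyperplane b hj ?_
    by_contra h
    exact hx fun h' => (h h').elim

variable [Fintype ι] [DecidableEq ι] [Nontrivial ι]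

/-- Write `x = p + (t / (n + 1)) u + y` with `u` the unit normal of facet `i` and `y` orthogonal to
`u`. The Jacobian absorbs the factor `n + 1`, and `η'((n + 1) λ_i)` becomes `η'(a t)` with `a =
‖∇λ_i‖`, independent of `n`. The remaining factors tend almost everywhere to the restriction of `g`
to the facet, and integrating `η'(a t)` in `t` leaves `a⁻¹`. -/
lemma tendsto_facet (i : ι) {g : Space d → ℝ} (hg : ContinuousOn g (convexHull ℝ (Set.range b))) :
    Tendsto (fun n : ℕ => ∫ x in convexHull ℝ (Set.range b), ((n : ℝ) + 1) *
        (deriv cutoff (((n : ℝ) + 1) * b.coord i x) *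
          ((∏ j ∈ Finset.univ.erase i, cutoff (((n : ℝ) + 1) * b.coord j x)) * g x))) atTop
      (𝓝 (‖coordGrad b i‖⁻¹ *
        ∫ x in facet b i, g x ∂(Measure.euclideanHausdorffMeasure (d - 1)))) := by
  obtain ⟨j₀, hj₀⟩ := exists_ne i
  set a := ‖coordGrad b i‖ with ha
  have ha0 : 0 < a := norm_pos_iff.2 (coordGrad_ne_zero b i)
  set u := a⁻¹ • coordGrad b i with hu
  set p := b j₀ with hp
  set K := convexHull ℝ (Set.range b) with hK
  have hKm : MeasurableSet K := (isCompact_simplex b).isClosed.measurableSet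
  have hu1 : ‖u‖ = 1 := norm_unit_coordGrad b i
  let Ψ : ℕ → ℝ × (ℝ ∙ u)ᗮ → Space d := fun n z =>
    p + ((((n : ℝ) + 1)⁻¹ * z.1) • u + (z.2 : Space d))
  have hΨc : ∀ n, Continuous (Ψ n) := fun n => by fun_prop
  have hN : ∀ n : ℕ, (0 : ℝ) < (n : ℝ) + 1 := fun n => by positivity
  have hΨi : ∀ n z, b.coord i (Ψ n z) = ((n : ℝ) + 1)⁻¹ * z.1 * a := fun n z =>
    coord_hyperplane b hj₀ _ _
  let H : ℕ → ℝ × (ℝ ∙ u)ᗮ → ℝ := fun n z => deriv cutoff (a * z.1) *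
    ((∏ j ∈ Finset.univ.erase i, cutoff (((n : ℝ) + 1) * b.coord j (Ψ n z))) *
      K.indicator g (Ψ n z))
  let H' : ℝ × (ℝ ∙ u)ᗮ → ℝ := fun z => deriv cutoff (a * z.1) *
    (facet b i).indicator g (p + (z.2 : Space d))
  have hint : ∀ n : ℕ, ∫ x in K, ((n : ℝ) + 1) *
        (deriv cutoff (((n : ℝ) + 1) * b.coord i x) *
          ((∏ j ∈ Finset.univ.erase i, cutoff (((n : ℝ) + 1) * b.coord j x)) * g x)) =
      ∫ z, H n z := by
    intro n
    rw [integral_const_mul, ← integral_indicator hKm]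
    have h := integral_slab hu1 p (inv_ne_zero (hN n).ne') (K.indicator fun x =>
      (deriv cutoff (((n : ℝ) + 1) * b.coord i x) *
          ((∏ j ∈ Finset.univ.erase i, cutoff (((n : ℝ) + 1) * b.coord j x)) * g x)))
    rw [inv_inv, abs_of_pos (hN n)] at h
    rw [← h]
    refine integral_congr_ae (Eventually.of_forall fun z => ?_)
    change K.indicator _ (Ψ n z) = H n z
    have h1 : ((n : ℝ) + 1) * b.coord i (Ψ n z) = a * z.1 := by
      rw [hΨi]
      have := (hN n).ne'
      field_simp
    by_cases hz : Ψ n z ∈ K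
    · simp only [Set.indicator_of_mem hz, H, h1]
    · simp only [Set.indicator_of_notMem hz, H, mul_zero]
  have hlim : ∫ z, H' z =
      a⁻¹ * ∫ x in facet b i, g x ∂(Measure.euclideanHausdorffMeasure (d - 1)) := by
    rw [integral_hyperplane (unit_coordGrad_ne_zero b i) p (isClosed_facet b i).measurableSet
      (facet_subset_hyperplane b hj₀)]
    have h := integral_prod_mul (μ := (volume : Measure ℝ))
      (ν := (volume : Measure (ℝ ∙ u)ᗮ)) (fun t => deriv cutoff (a * t))
      (fun y => (facet b i).indicator g (p + (y : Space d)))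
    rw [Measure.integral_comp_mul_left, integral_deriv_cutoff, smul_eq_mul, mul_one,
      abs_of_pos (inv_pos.2 ha0)] at h
    exact h
  simp only [hint]
  rw [← hlim]
  obtain ⟨C₁, hC₁⟩ := exists_bound_deriv_cutoff
  obtain ⟨C₂, hC₂⟩ := (isCompact_simplex b).exists_bound_of_continuousOn hg
  have hC₁0 : 0 ≤ C₁ := (abs_nonneg _).trans (hC₁ 0)
  have hpK : p ∈ K := subset_convexHull ℝ _ ⟨j₀, rfl⟩
  have hC₂0 : 0 ≤ C₂ := (norm_nonneg _).trans (hC₂ p hpK)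
  obtain ⟨R, hR⟩ := (isCompact_simplex b).isBounded.subset_closedBall p
  have hgm : Measurable (K.indicator g) := by
    classical
    rw [← Set.piecewise_eq_indicator]
    exact hg.measurable_piecewise continuousOn_const hKm
  -- The integrand vanishes unless `1 ≤ a t ≤ 2` and the point is in the simplex; `R` bounds the
  -- distance of the simplex from `p`, hence also the orthogonal component `y`.
  refine tendsto_integral_of_dominated_convergence
    ((Set.Icc (0 : ℝ) (2 / a) ×ˢ Metric.closedBall (0 : (ℝ ∙ u)ᗮ) R).indicator
      fun _ => C₁ * C₂) (fun n => ?_) ?_ (fun n => ?_) ?_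
  · refine Measurable.aestronglyMeasurable ?_
    refine Measurable.mul ?_ (Measurable.mul ?_ (hgm.comp (hΨc n).measurable))
    · exact (continuous_deriv_cutoff.comp (continuous_const.mul continuous_fst)).measurable
    · refine (continuous_finsetProd _ fun j _ => ?_).measurable
      exact contDiff_cutoff.continuous.comp
        (continuous_const.mul ((continuous_coord b j).comp (hΨc n)))
  · refine (integrable_indicator_iff (measurableSet_Icc.prod
      Metric.isClosed_closedBall.measurableSet)).2 (integrableOn_const ?_)
    exact (isCompact_Icc.prod (isCompact_closedBall _ _)).measure_lt_top.ne
  · refine Eventually.of_forall fun z => ?_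
    by_cases hz : z ∈ Set.Icc (0 : ℝ) (2 / a) ×ˢ Metric.closedBall (0 : (ℝ ∙ u)ᗮ) R
    · rw [Set.indicator_of_mem hz]
      simp only [H, norm_mul, Real.norm_eq_abs, Finset.abs_prod]
      refine mul_le_mul (hC₁ _) ?_ (by positivity) hC₁0
      rw [← one_mul C₂]
      refine mul_le_mul (Finset.prod_le_one (fun _ _ => abs_nonneg _)
        fun _ _ => abs_cutoff_le_one _) ?_ (abs_nonneg _) zero_le_one
      by_cases hzK : Ψ n z ∈ K
      · rw [Set.indicator_of_mem hzK]; exact hC₂ _ hzK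
      · rw [Set.indicator_of_notMem hzK, abs_zero]; exact hC₂0
    · rw [Set.indicator_of_notMem hz]
      refine (norm_eq_zero.2 ?_).le
      by_contra hne
      apply hz
      have hne1 : deriv cutoff (a * z.1) ≠ 0 := fun h => hne (by simp [H, h])
      have hne2 : Ψ n z ∈ K := by
        by_contra h
        exact hne (by simp [H, h])
      have ht : 1 ≤ a * z.1 ∧ a * z.1 ≤ 2 := by
        by_contra! h
        refine hne1 (deriv_cutoff_eq_zero ?_)
        by_cases h1 : a * z.1 < 1
        · exact Or.inl h1
        · exact Or.inr (h (not_lt.1 h1))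
      refine ⟨⟨?_, ?_⟩, ?_⟩
      · by_contra! h
        nlinarith
      · rw [le_div_iff₀ ha0]; linarith
      · have h1 := hR hne2
        rw [mem_closedBall_iff_norm] at h1 ⊢
        rw [sub_zero]
        refine le_trans ?_ h1
        have h2 : Ψ n z - p = (((n : ℝ) + 1)⁻¹ * z.1) • u + (z.2 : Space d) := by simp [Ψ]
        have h3 : ⟪(((n : ℝ) + 1)⁻¹ * z.1) • u, (z.2 : Space d)⟫ = 0 := by
          rw [inner_smul_left, Submodule.mem_orthogonal_singleton_iff_inner_right.1 z.2.2, mul_zero]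
        have h4 := norm_add_sq_eq_norm_sq_add_norm_sq_of_inner_eq_zero _ _ h3
        rw [h2]
        refine nonneg_le_nonneg_of_sq_le_sq (norm_nonneg _) ?_
        rw [h4, Submodule.coe_norm]
        exact le_add_of_nonneg_left (mul_self_nonneg _)
  -- Discarding the null set where some other coordinate vanishes, the limit point is either
  -- strictly outside the simplex or in the relative interior of the facet.
  · have h := (Measure.quasiMeasurePreserving_snd (μ := (volume : Measure ℝ))
      (ν := (volume : Measure (ℝ ∙ u)ᗮ))).ae (ae_coord_ne_zero b hj₀)
    filter_upwards [h] with z hz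
    -- Where `η'(a t)` can be nonzero, `t` is positive, so the approach to the facet is from the
    -- side `λ_i > 0`.
    by_cases ht : a * z.1 < 1
    · simp [H, H', deriv_cutoff_eq_zero (Or.inl ht)]
    have ht0 : 0 < z.1 := by
      by_contra! h
      nlinarith
    refine Tendsto.const_mul _ ?_
    have hΨlim : Tendsto (fun n => Ψ n z) atTop (𝓝 (p + (z.2 : Space d))) := by
      have h1 : Tendsto (fun n : ℕ => (((n : ℝ) + 1)⁻¹ * z.1) • u) atTop (𝓝 ((0 * z.1) • u)) := by
        refine Tendsto.smul_const (Tendsto.mul_const _ ?_) _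
        simpa using tendsto_one_div_add_atTop_nhds_zero_nat (𝕜 := ℝ)
      have h2 := (h1.add_const (z.2 : Space d)).const_add p
      simpa using h2
    have hcoord : ∀ j, Tendsto (fun n => b.coord j (Ψ n z)) atTop
        (𝓝 (b.coord j (p + (z.2 : Space d)))) := fun j =>
      ((continuous_coord b j).tendsto _).comp hΨlim
    by_cases hneg : ∃ k, k ≠ i ∧ b.coord k (p + (z.2 : Space d)) < 0
    · obtain ⟨k, hki, hk⟩ := hneg
      rw [Set.indicator_of_notMem fun h => (h.2 k).not_gt hk]
      refine tendsto_const_nhds.congr' ?_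
      filter_upwards [(hcoord k).eventually_lt_const hk] with n hn
      rw [Set.indicator_of_notMem fun h => ((mem_simplex b).1 h k).not_gt hn, mul_zero]
    · push Not at hneg
      have hpos : ∀ k, k ≠ i → 0 < b.coord k (p + (z.2 : Space d)) := fun k hk =>
        lt_of_le_of_ne (hneg k hk) (hz k hk).symm
      have hi0 : b.coord i (p + (z.2 : Space d)) = 0 := by
        have := coord_hyperplane b hj₀ 0 z.2
        simpa using this
      have hF : p + (z.2 : Space d) ∈ facet b i := by
        refine ⟨hi0, fun k => ?_⟩
        by_cases hk : k = i
        · rw [hk, hi0]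
        · exact (hpos k hk).le
      rw [Set.indicator_of_mem hF]
      have hΨK : ∀ᶠ n in atTop, Ψ n z ∈ K := by
        have : ∀ᶠ n in atTop, ∀ k, 0 ≤ b.coord k (Ψ n z) := by
          rw [eventually_all]
          intro k
          by_cases hk : k = i
          · refine Eventually.of_forall fun n => ?_
            rw [hk, hΨi]
            have := hN n
            positivity
          · filter_upwards [(hcoord k).eventually_const_lt (hpos k hk)] with n hn using hn.le
        filter_upwards [this] with n hn using (mem_simplex b).2 hn
      have hprod : ∀ᶠ n : ℕ in atTop,
          ∏ j ∈ Finset.univ.erase i, cutoff (((n : ℝ) + 1) * b.coord j (Ψ n z)) = 1 := by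
        -- The other coordinates stay bounded below while the scale grows, so their cutoffs saturate
        -- at `1`.
        have : ∀ᶠ n : ℕ in atTop, ∀ k, k ≠ i → 2 ≤ ((n : ℝ) + 1) * b.coord k (Ψ n z) := by
          rw [eventually_all]
          intro k
          by_cases hk : k = i
          · simp [hk]
          · have h1 : Tendsto (fun n : ℕ => (n : ℝ) + 1) atTop atTop :=
              tendsto_atTop_add_const_right _ _ tendsto_natCast_atTop_atTop
            filter_upwards [(h1.atTop_mul_pos (hpos k hk) (hcoord k)).eventually_ge_atTop 2]
              with n hn _ using hn
        filter_upwards [this] with n hn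
        exact Finset.prod_eq_one fun k hk => cutoff_of_two_le (hn k (Finset.ne_of_mem_erase hk))
      have hg' : Tendsto (fun n => g (Ψ n z)) atTop (𝓝 (g (p + (z.2 : Space d)))) :=
        (hg _ (facet_subset_simplex b i hF)).tendsto.comp
          (tendsto_nhdsWithin_iff.2 ⟨hΨlim, hΨK⟩)
      refine hg'.congr' ?_
      filter_upwards [hΨK, hprod] with n hn1 hn2
      rw [hn2, one_mul, Set.indicator_of_mem hn1]

end Flux

section Simplex

variable {d : ℕ}

/-- The divergence theorem on a simplex, for a continuous field which is divergence-free in the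
sense of distributions. -/
theorem sum_facet_flux_eq_zero {ι : Type*} [Fintype ι] [Nontrivial ι]
    (b : AffineBasis ι ℝ (Space d)) {v : Space d → Space d}
    (hv : ContinuousOn v (convexHull ℝ (Set.range b)))
    (hdiv : ∀ φ : Space d → ℝ, ContDiff ℝ (⊤ : ℕ∞) φ → HasCompactSupport φ →
      tsupport φ ⊆ interior (convexHull ℝ (Set.range b)) →
        ∫ x in convexHull ℝ (Set.range b), ⟪v x, ∇ φ x⟫ = 0) :
    ∑ i, ∫ x in facet b i, ⟪v x, -(‖coordGrad b i‖⁻¹ • coordGrad b i)⟫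
      ∂(Measure.euclideanHausdorffMeasure (d - 1)) = 0 := by
  classical
  set K := convexHull ℝ (Set.range b)
  have hg : ∀ i, ContinuousOn (fun x => ⟪v x, coordGrad b i⟫) K := fun i =>
    hv.inner continuousOn_const
  have hlim := tendsto_finsetSum Finset.univ fun i _ => tendsto_facet b i (hg i)
  have hzero : ∀ n : ℕ, ∑ i, ∫ x in K, ((n : ℝ) + 1) *
      (deriv cutoff (((n : ℝ) + 1) * b.coord i x) *
        ((∏ j ∈ Finset.univ.erase i, cutoff (((n : ℝ) + 1) * b.coord j x)) *
          ⟪v x, coordGrad b i⟫)) = 0 := by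
    intro n
    have hn : (0 : ℝ) < (n : ℝ) + 1 := by positivity
    rw [← integral_finsetSum]
    · rw [← hdiv (bump b ((n : ℝ) + 1)) (contDiff_bump b _) (hasCompactSupport_bump b hn)
        (by rw [AffineBasis.interior_convexHull]; exact tsupport_bump_subset b hn)]
      simp only [inner_gradient_bump]
    · intro i _
      refine ContinuousOn.integrableOn_compact (isCompact_simplex b) ?_
      refine continuousOn_const.mul (ContinuousOn.mul ?_ (ContinuousOn.mul ?_ (hg i)))
      · exact (continuous_deriv_cutoff.comp
          (continuous_const.mul (continuous_coord b i))).continuousOn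
      · exact (continuous_finsetProd _ fun j _ => contDiff_cutoff.continuous.comp
          (continuous_const.mul (continuous_coord b j))).continuousOn
  have h := tendsto_nhds_unique hlim (tendsto_const_nhds.congr fun n => (hzero n).symm)
  rw [← neg_eq_zero, ← h, ← Finset.sum_neg_distrib]
  refine Finset.sum_congr rfl fun i _ => ?_
  rw [← integral_const_mul, ← integral_neg]
  simp [inner_smul_right]

/-! ### Facets of a simplex given by its vertices -/

lemma affineMap_centroid {s : Finset (Space d)} (hs : s.Nonempty) (f : Space d →ᵃ[ℝ] ℝ) :
    f (s.centroid ℝ id) = ∑ x ∈ s, (s.card : ℝ)⁻¹ * f x := by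
  have h1 := s.sum_centroidWeights_eq_one_of_nonempty ℝ hs
  rw [Finset.centroid_def, Finset.map_affineCombination _ _ _ h1,
    Finset.affineCombination_eq_linear_combination _ _ _ h1]
  simp

variable {K : Finset (Space d)} (b : AffineBasis K ℝ (Space d)) (hb : ⇑b = Subtype.val)

include hb

lemma coord_vertex [DecidableEq (Space d)] (i : K) {x : Space d} (hx : x ∈ K) :
    b.coord i x = if (i : Space d) = x then 1 else 0 := by
  have h := b.coord_apply i ⟨x, hx⟩
  rw [hb] at h
  rw [h]
  simp [← Subtype.coe_inj]

lemma convexHull_subset_coord_eq_zero (i : K) {s : Finset (Space d)} (hs : s ⊆ K)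
    (hi : (i : Space d) ∉ s) {x : Space d} (hx : x ∈ convexHull ℝ (s : Set (Space d))) :
    b.coord i x = 0 := by
  classical
  have hconv : Convex ℝ {y | b.coord i y = 0} :=
    (convex_singleton (0 : ℝ)).affine_preimage (b.coord i)
  refine convexHull_min (fun y hy => ?_) hconv hx
  have : (i : Space d) ≠ y := fun h => hi (h ▸ hy)
  simp [coord_vertex b hb i (hs hy), this]

lemma convexHull_erase [DecidableEq (Space d)] (i : K) :
    convexHull ℝ ((K.erase i : Finset (Space d)) : Set (Space d)) = facet b i := by
  refine Set.Subset.antisymm (fun x hx => ?_) fun x hx => ?_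
  · refine ⟨convexHull_subset_coord_eq_zero b hb i (Finset.erase_subset _ _)
      (Finset.notMem_erase _ _) hx, (mem_simplex b).1 ?_⟩
    rw [hb, Subtype.range_coe]
    exact convexHull_mono (Finset.coe_subset.2 (Finset.erase_subset _ _)) hx
  · have h1 := b.linear_combination_coord_eq_self x
    have h2 := b.sum_coord_apply_eq_one x
    rw [← Finset.add_sum_erase _ _ (Finset.mem_univ i), hx.1] at h1 h2
    rw [zero_smul, zero_add] at h1
    rw [zero_add] at h2
    rw [← h1]
    refine (convex_convexHull ℝ _).sum_mem (fun j _ => hx.2 j) h2 fun j hj => ?_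
    refine subset_convexHull ℝ _ ?_
    rw [hb]
    simpa using Finset.ne_of_mem_erase hj

/-- The coordinate `λ_i` is constant on the facet, so its gradient is normal to it; affine
independence makes the normal space a line. -/
lemma orthogonal_vectorSpan_erase [DecidableEq (Space d)] (hd : 1 ≤ d) (hK : K.card = d + 1)
    [Nontrivial K] (i : K) :
    (vectorSpan ℝ ((K.erase i : Finset (Space d)) : Set (Space d)))ᗮ = ℝ ∙ coordGrad b i := by
  symm
  refine Submodule.eq_of_le_of_finrank_eq ?_ ?_
  · rw [Submodule.span_singleton_le_iff_mem, vectorSpan_def, Submodule.mem_orthogonal]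
    intro w hw
    induction hw using Submodule.span_induction with
    | mem w hw =>
      obtain ⟨x, hx, y, hy, rfl⟩ := hw
      have h := coord_eq_add_inner b i y x
      have hz : ∀ z ∈ ((K.erase i : Finset (Space d)) : Set (Space d)), b.coord i z = 0 :=
        fun z hz => convexHull_subset_coord_eq_zero b hb i (Finset.erase_subset _ _)
          (Finset.notMem_erase _ _) (subset_convexHull ℝ _ hz)
      rw [hz x hx, hz y hy, zero_add] at h
      rw [real_inner_comm]
      exact h.symm
    | zero => simp
    | add w w' _ _ h h' => rw [inner_add_left, h, h', add_zero]
    | smul c w _ h => rw [inner_smul_left, h, mul_zero]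
  · rw [finrank_span_singleton (coordGrad_ne_zero b i)]
    have hind : AffineIndependent ℝ (Subtype.val : {x // x ∈ K.erase i} → Space d) := by
      have h := b.ind
      rw [hb] at h
      exact h.mono (s := ((K.erase i : Finset (Space d)) : Set (Space d)))
        (t := (K : Set (Space d))) (Finset.coe_subset.2 (Finset.erase_subset _ _))
    have h1 := hind.finrank_vectorSpan (n := d - 1) (by
      rw [Fintype.card_coe, Finset.card_erase_of_mem i.2, hK]; omega)
    have h2 := (vectorSpan ℝ ((K.erase i : Finset (Space d)) : Set (Space d))
      ).finrank_add_finrank_orthogonal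
    rw [finrank_euclideanSpace_fin] at h2
    have h1' : Module.finrank ℝ (vectorSpan ℝ ((K.erase i : Finset (Space d)) : Set (Space d)))
      = d - 1 := (congrArg (fun s : Set (Space d) => Module.finrank ℝ (vectorSpan ℝ s))
        Subtype.range_coe.symm).trans h1
    omega

/-- The outer unit normal is the normalized opposite of the gradient of the barycentric coordinate
of the opposite vertex. -/
lemma outerNormal_erase [DecidableEq (Space d)] (hd : 1 ≤ d) (hK : K.card = d + 1)
    [Nontrivial K] (i : K) :
    outerNormal K (K.erase i) = -(‖coordGrad b i‖⁻¹ • coordGrad b i) := by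
  have hne : (K.erase i).Nonempty := by
    rw [← Finset.card_pos, Finset.card_erase_of_mem i.2]; omega
  have h1 := affineMap_centroid hne (b.coord i)
  have h2 := affineMap_centroid (s := K) ⟨i, i.2⟩ (b.coord i)
  rw [Finset.sum_eq_zero fun x hx => by
    rw [coord_vertex b hb i (Finset.mem_of_mem_erase hx),
      if_neg (Finset.ne_of_mem_erase hx).symm, mul_zero]] at h1
  rw [Finset.sum_eq_single (i : Space d) (fun x hx hxi => by
    rw [coord_vertex b hb i hx, if_neg hxi.symm, mul_zero]) (fun h => (h i.2).elim),
    coord_vertex b hb i i.2, if_pos rfl, mul_one] at h2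
  have h3 := coord_eq_add_inner b i (K.centroid ℝ id) ((K.erase i).centroid ℝ id)
  rw [h1, h2] at h3
  have ha : 0 < ‖coordGrad b i‖ := norm_pos_iff.2 (coordGrad_ne_zero b i)
  have hc : (0 : ℝ) < (K.card : ℝ)⁻¹ := by rw [hK]; positivity
  -- `λ_i` is `0` at the centroid of the facet and `1 / card K` at that of the simplex; the negative
  -- sign fixes the exterior direction.
  have h4 : ⟪coordGrad b i, (K.erase i).centroid ℝ id - K.centroid ℝ id⟫ = -(K.card : ℝ)⁻¹ := by
    linarith
  have h5 : ∀ c : ℝ, c < 0 →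
      ‖c • coordGrad b i‖⁻¹ • c • coordGrad b i = -(‖coordGrad b i‖⁻¹ • coordGrad b i) := by
    intro c hc
    rw [norm_smul, smul_smul, Real.norm_eq_abs, abs_of_neg hc, ← neg_smul]
    congr 1
    have := hc.ne
    field_simp
  rw [outerNormal]
  simp only [orthogonal_vectorSpan_erase b hb hd hK i, Submodule.starProjection_singleton, h4]
  refine h5 _ (div_neg_of_neg_of_pos (neg_neg_of_pos hc) ?_)
  simpa using pow_pos ha 2

end Simplex

/-! ### Simplices near a point of a facet -/

section Local

variable {d : ℕ} {ι : Type*} [Finite ι] (b : AffineBasis ι ℝ (Space d))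

/-- Near a point of the relative interior of a facet, a simplex is a half-space. -/
lemma eventually_mem_simplex_iff {i : ι} {x : Space d} (hx : ∀ k, k ≠ i → 0 < b.coord k x) :
    ∀ᶠ y in 𝓝 x, y ∈ convexHull ℝ (Set.range b) ↔ 0 ≤ b.coord i y := by
  have h : ∀ᶠ y in 𝓝 x, ∀ k, k ≠ i → 0 < b.coord k y := by
    rw [eventually_all]
    intro k
    by_cases hk : k = i
    · simp [hk]
    · filter_upwards [((continuous_coord b k).tendsto x).eventually_const_lt (hx k hk)]
        with y hy _ using hy
  filter_upwards [h] with y hy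
  refine ⟨fun h' => (mem_simplex b).1 h' i, fun h' => (mem_simplex b).2 fun k => ?_⟩
  by_cases hk : k = i
  · rwa [hk]
  · exact (hy k hk).le

omit [Finite ι] in
-- Moving against the gradient from a point with `λ_i ≤ 0` leaves the half-space at once. This is
-- how a local description of `closure Ω` becomes one of its interior.
lemma coord_nonneg_mem_nhds_iff [Nontrivial ι] (i : ι) (y : Space d) :
    {z | 0 ≤ b.coord i z} ∈ 𝓝 y ↔ 0 < b.coord i y := by
  constructor
  · intro h
    have hlim : Tendsto (fun t : ℝ => y + t • (-coordGrad b i)) (𝓝[>] 0) (𝓝 y) := by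
      have : ContinuousAt (fun t : ℝ => y + t • (-coordGrad b i)) 0 := by fun_prop
      have h' := this.tendsto
      rw [zero_smul, add_zero] at h'
      exact h'.mono_left nhdsWithin_le_nhds
    obtain ⟨t, ht, ht0⟩ := ((hlim.eventually h).and self_mem_nhdsWithin).exists
    have h1 : 0 ≤ b.coord i (y + t • (-coordGrad b i)) := ht
    rw [coord_add, inner_smul_right, inner_neg_right, real_inner_self_eq_norm_sq] at h1
    have h2 : 0 < t * ‖coordGrad b i‖ ^ 2 :=
      mul_pos ht0 (pow_pos (norm_pos_iff.2 (coordGrad_ne_zero b i)) 2)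
    linarith
  · intro h
    filter_upwards [((continuous_coord b i).tendsto y).eventually_const_lt h] with z hz using hz.le

end Local

/-! ### Geometry of the mesh -/

section Geometry

variable {d : ℕ} {Ω : Set (Space d)} {𝒯 : Mesh Ω}

/-- The vertices of an element, as an affine basis. -/
noncomputable def Mesh.Elem.basis (K : 𝒯.Elem) : AffineBasis K.1 ℝ (Space d) where
  toFun := Subtype.val
  ind' := 𝒯.complex.indep K.2.1
  tot' := by
    refine (𝒯.complex.indep K.2.1).affineSpan_eq_top_iff_card_eq_finrank_add_one.2 ?_
    rw [Fintype.card_coe, K.2.2, finrank_euclideanSpace_fin]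

lemma Mesh.Elem.coe_basis (K : 𝒯.Elem) : ⇑K.basis = Subtype.val := rfl

lemma Mesh.Elem.carrier_eq (K : 𝒯.Elem) : K.carrier = convexHull ℝ (Set.range K.basis) := by
  rw [K.coe_basis, Subtype.range_coe]; rfl

lemma Mesh.Elem.nontrivial (hd : 1 ≤ d) (K : 𝒯.Elem) : Nontrivial K.1 := by
  rw [← Fintype.one_lt_card_iff_nontrivial, Fintype.card_coe, K.2.2]
  omega

lemma Mesh.Elem.isCompact_carrier (K : 𝒯.Elem) : IsCompact K.carrier := by
  rw [K.carrier_eq]; exact isCompact_simplex _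

lemma Mesh.Elem.carrier_subset (K : 𝒯.Elem) : K.carrier ⊆ closure Ω := by
  rw [← 𝒯.space_eq]
  exact 𝒯.complex.convexHull_subset_space K.2.1

lemma Mesh.mem_closure_iff (𝒯 : Mesh Ω) {x : Space d} :
    x ∈ closure Ω ↔ ∃ K : 𝒯.Elem, x ∈ K.carrier := by
  refine ⟨fun hx => ?_, fun ⟨K, hK⟩ => K.carrier_subset hK⟩
  rw [← 𝒯.space_eq, Geometry.SimplicialComplex.mem_space_iff] at hx
  obtain ⟨s, hs, hxs⟩ := hx
  obtain ⟨t, ht, hst, htc⟩ := 𝒯.pure s hs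
  exact ⟨⟨t, ht, htc⟩, convexHull_mono (Finset.coe_subset.2 hst) hxs⟩

lemma Mesh.Elem.volume_pos (K : 𝒯.Elem) : 0 < volume.real K.carrier := by
  rw [measureReal_def, ENNReal.toReal_pos_iff]
  refine ⟨?_, K.isCompact_carrier.measure_lt_top⟩
  refine Measure.measure_pos_of_nonempty_interior _ ?_
  rw [K.carrier_eq]
  exact ⟨_, K.basis.centroid_mem_interior_convexHull⟩

lemma Mesh.Elem.eq_of_subset {K L : 𝒯.Elem} (h : K.1 ⊆ L.1) : K = L :=
  Subtype.ext (Finset.eq_of_subset_of_card_le h (by rw [K.2.2, L.2.2]))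

variable [DecidableEq (Space d)]

lemma exists_eq_erase {K e : Finset (Space d)} (heK : e ⊆ K) (hK : K.card = d + 1)
    (he : e.card = d) : ∃ i : K, e = K.erase i := by
  have h : (K \ e).card = 1 := by rw [Finset.card_sdiff_of_subset heK, hK, he]; omega
  obtain ⟨i, hi⟩ := Finset.card_eq_one.1 h
  have hiK : i ∈ K \ e := by rw [hi]; exact Finset.mem_singleton_self i
  rw [Finset.mem_sdiff] at hiK
  refine ⟨⟨i, hiK.1⟩, Finset.eq_of_subset_of_card_le (Finset.subset_erase.2 ⟨heK, hiK.2⟩) ?_⟩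
  rw [Finset.card_erase_of_mem hiK.1, hK, he]
  omega

lemma Mesh.Elem.coord_centroid_erase_pos (K : 𝒯.Elem) (i k : K.1) (hk : k ≠ i) :
    0 < K.basis.coord k ((K.1.erase i).centroid ℝ id) := by
  have hk' : (k : Space d) ∈ K.1.erase i :=
    Finset.mem_erase.2 ⟨fun h => hk (Subtype.ext h), k.2⟩
  have hc : (0 : ℝ) < ((K.1.erase i).card : ℝ)⁻¹ := by
    have := Finset.card_pos.2 ⟨_, hk'⟩
    positivity
  have hv : ∀ x ∈ K.1.erase (i : Space d), K.basis.coord k x = if (k : Space d) = x then 1 else 0 :=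
    fun x hx => coord_vertex K.basis K.coe_basis k (Finset.mem_of_mem_erase hx)
  rw [affineMap_centroid ⟨_, hk'⟩]
  refine Finset.sum_pos' (fun x hx => ?_) ⟨k, hk', ?_⟩
  · rw [hv x hx]
    split_ifs <;> simp
  · rw [hv k hk', if_pos rfl, mul_one]
    exact hc

/-- A vertex of an element `K` that is not a vertex of `L` has zero barycentric coordinate on the
intersection. -/
lemma Mesh.Elem.coord_eq_zero_of_mem_inter (K L : 𝒯.Elem) (i : K.1) (hi : (i : Space d) ∉ L.1)
    {x : Space d} (hxK : x ∈ K.carrier) (hxL : x ∈ L.carrier) : K.basis.coord i x = 0 := by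
  have h := 𝒯.complex.inter_subset_convexHull K.2.1 L.2.1 ⟨hxK, hxL⟩
  rw [← Finset.coe_inter] at h
  exact convexHull_subset_coord_eq_zero K.basis K.coe_basis i Finset.inter_subset_left
    (fun h' => hi (Finset.mem_inter.1 h').2) h

/-- Two elements that share a facet have opposite outer normals there. -/
lemma Mesh.Elem.outerNormal_eq_neg (hd : 1 ≤ d) {K L : 𝒯.Elem} (hKL : K ≠ L)
    {e : Finset (Space d)} (he : e.card = d) (heK : e ⊆ K.1) (heL : e ⊆ L.1) :
    outerNormal L.1 e = -outerNormal K.1 e := by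
  have := K.nontrivial hd
  have := L.nontrivial hd
  obtain ⟨i, hi⟩ := exists_eq_erase heK K.2.2 he
  obtain ⟨j, hj⟩ := exists_eq_erase heL L.2.2 he
  have hnK := outerNormal_erase K.basis K.coe_basis hd K.2.2 i
  have hnL := outerNormal_erase L.basis L.coe_basis hd L.2.2 j
  have hoK := orthogonal_vectorSpan_erase K.basis K.coe_basis hd K.2.2 i
  have hoL := orthogonal_vectorSpan_erase L.basis L.coe_basis hd L.2.2 j
  rw [← hi] at hnK hoK
  rw [← hj, hoK] at hoL
  rw [← hj] at hnL
  -- Both gradients are normal to the same facet, hence proportional; only the sign of the ratio `c`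
  -- is at stake.
  have ha' : coordGrad L.basis j ∈ ℝ ∙ coordGrad K.basis i := by
    rw [hoL]; exact Submodule.mem_span_singleton_self _
  obtain ⟨c, hc⟩ := Submodule.mem_span_singleton.1 ha'
  have ha : 0 < ‖coordGrad K.basis i‖ := norm_pos_iff.2 (coordGrad_ne_zero K.basis i)
  have hc0 : c ≠ 0 := by
    rintro rfl
    exact coordGrad_ne_zero L.basis j (by rw [← hc, zero_smul])
  rcases hc0.lt_or_gt with hneg | hpos
  · rw [hnK, hnL, ← hc, norm_smul, smul_smul, Real.norm_eq_abs, abs_of_neg hneg, neg_neg,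
      ← neg_smul]
    congr 1
    field_simp
  -- If the gradients point the same way, a small move along them from the centroid of the facet
  -- enters both simplices off the facet, against conformity.
  · exfalso
    set x := e.centroid ℝ id with hx
    have hne : e.Nonempty := by rw [← Finset.card_pos, he]; omega
    have hxe : x ∈ convexHull ℝ (e : Set (Space d)) := Finset.centroid_mem_convexHull e hne
    have h1 : ∀ᶠ y in 𝓝 x, y ∈ K.carrier ↔ 0 ≤ K.basis.coord i y := by
      rw [K.carrier_eq]
      exact eventually_mem_simplex_iff K.basis fun k hk => by
        rw [hx, hi]; exact K.coord_centroid_erase_pos i k hk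
    have h2 : ∀ᶠ y in 𝓝 x, y ∈ L.carrier ↔ 0 ≤ L.basis.coord j y := by
      rw [L.carrier_eq]
      exact eventually_mem_simplex_iff L.basis fun k hk => by
        rw [hx, hj]; exact L.coord_centroid_erase_pos j k hk
    have hlim : Tendsto (fun t : ℝ => x + t • coordGrad K.basis i) (𝓝[>] 0) (𝓝 x) := by
      have : ContinuousAt (fun t : ℝ => x + t • coordGrad K.basis i) 0 := by fun_prop
      have h' := this.tendsto
      rw [zero_smul, add_zero] at h'
      exact h'.mono_left nhdsWithin_le_nhds
    obtain ⟨t, ⟨ht1, ht2⟩, ht0⟩ :=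
      ((hlim.eventually (h1.and h2)).and self_mem_nhdsWithin).exists
    have ht0 : 0 < t := ht0
    have hxi : K.basis.coord i x = 0 := convexHull_subset_coord_eq_zero K.basis K.coe_basis i heK
      (by rw [hi]; exact Finset.notMem_erase _ _) hxe
    have hxj : L.basis.coord j x = 0 := convexHull_subset_coord_eq_zero L.basis L.coe_basis j heL
      (by rw [hj]; exact Finset.notMem_erase _ _) hxe
    have h3 : 0 < K.basis.coord i (x + t • coordGrad K.basis i) := by
      rw [coord_add, hxi, inner_smul_right, real_inner_self_eq_norm_sq]
      positivity
    have h4 : 0 < L.basis.coord j (x + t • coordGrad K.basis i) := by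
      rw [coord_add, hxj, ← hc, inner_smul_right, inner_smul_left, real_inner_self_eq_norm_sq]
      simp only [conj_trivial]
      positivity
    have hiL : (i : Space d) ∉ L.1 := by
      intro h
      refine hKL (Mesh.Elem.eq_of_subset fun y hy => ?_)
      by_cases hyi : y = i
      · rwa [hyi]
      · exact heL (by rw [hi]; exact Finset.mem_erase.2 ⟨hyi, hy⟩)
    exact h3.ne' (K.coord_eq_zero_of_mem_inter L i hiL (ht1.2 h3.le) (ht2.2 h4.le))

lemma Mesh.Elem.norm_outerNormal (hd : 1 ≤ d) (K : 𝒯.Elem) (i : K.1) :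
    ‖outerNormal K.1 (K.1.erase i)‖ = 1 := by
  have := K.nontrivial hd
  rw [outerNormal_erase K.basis K.coe_basis hd K.2.2 i, norm_neg, norm_unit_coordGrad]

/-- An element that contains an interior edge is one of the two elements of that edge. -/
lemma Mesh.Orientation.eq_left_or_eq_right (hd : 1 ≤ d) (o : 𝒯.Orientation) (e : 𝒯.IntEdge)
    {K : 𝒯.Elem} (he : e.1 ⊆ K.1) : K = o.left e ∨ K = o.right e := by
  -- With a third element on the facet, the three outer normals would be pairwise opposite, so each
  -- would be its own negative.
  by_contra! h
  have h1 := Mesh.Elem.outerNormal_eq_neg hd (o.ne e) e.2.2.1 (o.subset_left e) (o.subset_right e)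
  have h2 := Mesh.Elem.outerNormal_eq_neg hd h.1 e.2.2.1 he (o.subset_left e)
  have h3 := Mesh.Elem.outerNormal_eq_neg hd h.2 e.2.2.1 he (o.subset_right e)
  obtain ⟨i, hi⟩ := exists_eq_erase he K.2.2 e.2.2.1
  have h4 := K.norm_outerNormal hd i
  rw [← hi] at h4
  rw [h2, h3, neg_neg] at h1
  have h5 : (2 : ℝ) • outerNormal K.1 e.1 = 0 := by
    rw [two_smul]
    nth_rw 1 [← h1]
    exact neg_add_cancel _
  rw [(smul_eq_zero.1 h5).resolve_left two_ne_zero, norm_zero] at h4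
  exact zero_ne_one h4

/-- A facet of an element which is not an interior edge consists, up to its relative boundary, of
flat boundary points. -/
lemma Mesh.Elem.isOutwardNormalAt (hd : 1 ≤ d) (hΩ : interior (closure Ω) = Ω) (K : 𝒯.Elem)
    (i : K.1) (hi : ∀ L : 𝒯.Elem, K.1.erase i ⊆ L.1 → L = K) {x : Space d}
    (hx0 : K.basis.coord i x = 0) (hx : ∀ k, k ≠ i → 0 < K.basis.coord k x) :
    IsOutwardNormalAt Ω x (outerNormal K.1 (K.1.erase i)) := by
  have := K.nontrivial hd
  refine ⟨K.norm_outerNormal hd i, ?_⟩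
  have hxK : x ∈ K.carrier := by
    rw [K.carrier_eq, mem_simplex]
    intro k
    by_cases hk : k = i
    · rw [hk, hx0]
    · exact (hx k hk).le
  have h1 : ∀ᶠ y in 𝓝 x, ∀ L : 𝒯.Elem, L ≠ K → y ∉ L.carrier := by
    rw [eventually_all]
    intro L
    by_cases hL : L = K
    · simp [hL]
    · have hxL : x ∉ L.carrier := by
        intro hxL
        refine hL (hi L fun y hy => ?_)
        by_contra hyL
        have hyK := Finset.mem_of_mem_erase hy
        refine (hx ⟨y, hyK⟩ fun h => Finset.ne_of_mem_erase hy (congrArg Subtype.val h)).ne' ?_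
        exact K.coord_eq_zero_of_mem_inter L ⟨y, hyK⟩ hyL hxK hxL
      filter_upwards [L.isCompact_carrier.isClosed.isOpen_compl.mem_nhds hxL] with y hy _ using hy
  have h2 : ∀ᶠ y in 𝓝 x, y ∈ K.carrier ↔ 0 ≤ K.basis.coord i y := by
    rw [K.carrier_eq]; exact eventually_mem_simplex_iff K.basis hx
  have h3 : ∀ᶠ y in 𝓝 x, y ∈ closure Ω ↔ 0 ≤ K.basis.coord i y := by
    filter_upwards [h1, h2] with y hy1 hy2
    rw [← hy2, 𝒯.mem_closure_iff]
    refine ⟨fun ⟨L, hL⟩ => ?_, fun h => ⟨K, h⟩⟩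
    by_cases hLK : L = K
    · rwa [hLK] at hL
    · exact (hy1 L hLK hL).elim
  -- The closure is a closed half-space near every `y` close to `x`, so its interior, which is `Ω`,
  -- is the open one.
  filter_upwards [eventually_eventually_nhds.2 h3] with y hy
  have h4 : y ∈ Ω ↔ 0 < K.basis.coord i y := by
    rw [← coord_nonneg_mem_nhds_iff K.basis i y]
    have h5 : y ∈ Ω ↔ closure Ω ∈ 𝓝 y := by
      rw [← mem_interior_iff_mem_nhds, hΩ]
    exact h5.trans (Filter.eventually_congr hy)
  rw [h4, outerNormal_erase K.basis K.coe_basis hd K.2.2 i, coord_eq_add_inner K.basis i x y, hx0,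
    zero_add, inner_neg_left, inner_smul_left, neg_lt_zero]
  have ha : 0 < ‖coordGrad K.basis i‖ := norm_pos_iff.2 (coordGrad_ne_zero K.basis i)
  simp [ha]

end Geometry

/-! ### Flux through the boundary of an element -/

section ElementFlux

variable {d : ℕ} {Ω : Set (Space d)} {𝒯 : Mesh Ω}

/-- The flux of `v` through the facet `e` of the simplex `K`, outward from `K`. -/
noncomputable def facetFlux (v : Space d → Space d) (K e : Finset (Space d)) : ℝ :=
  ∫ x in convexHull ℝ (e : Set (Space d)), ⟪v x, outerNormal K e⟫
    ∂(Measure.euclideanHausdorffMeasure (d - 1))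

lemma measure_facet_lt_top {ι : Type*} [Finite ι] [Nontrivial ι] (b : AffineBasis ι ℝ (Space d))
    (i : ι) : Measure.euclideanHausdorffMeasure (d - 1) (facet b i) < ⊤ := by
  obtain ⟨j, hj⟩ := exists_ne i
  rw [measure_hyperplane (unit_coordGrad_ne_zero b i) (b j) (facet_subset_hyperplane b hj)]
  exact ((isometry_hyperplane _ _).isClosedEmbedding.isCompact_preimage
    ((isCompact_simplex b).of_isClosed_subset (isClosed_facet b i)
      (facet_subset_simplex b i))).measure_lt_top

lemma Mesh.IntEdge.carrier_subset (e : 𝒯.IntEdge) : e.carrier ⊆ closure Ω := by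
  rw [← 𝒯.space_eq]
  exact 𝒯.complex.convexHull_subset_space e.2.1

lemma Mesh.IntEdge.isCompact_carrier (e : 𝒯.IntEdge) : IsCompact e.carrier :=
  e.1.finite_toSet.isCompact_convexHull ℝ

lemma Mesh.IntEdge.measure_carrier_lt_top (hd : 1 ≤ d) (e : 𝒯.IntEdge) :
    Measure.euclideanHausdorffMeasure (d - 1) e.carrier < ⊤ := by
  classical
  obtain ⟨K, -, -, heK, -⟩ := e.2.2.2
  have := K.nontrivial hd
  obtain ⟨i, hi⟩ := exists_eq_erase heK K.2.2 e.2.2.1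
  rw [Mesh.IntEdge.carrier, hi, convexHull_erase K.basis K.coe_basis]
  exact measure_facet_lt_top _ _

/-- Needed to compare integrals pointwise in `upwLinear_nonpos`. -/
lemma Mesh.IntEdge.integrableOn (hd : 1 ≤ d) (e : 𝒯.IntEdge) {g : Space d → ℝ}
    (hg : ContinuousOn g (closure Ω)) :
    IntegrableOn g e.carrier (Measure.euclideanHausdorffMeasure (d - 1)) := by
  have hg' := hg.mono e.carrier_subset
  obtain ⟨C, hC⟩ := e.isCompact_carrier.exists_bound_of_continuousOn hg'
  have hm := e.isCompact_carrier.isClosed.measurableSet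
  refine IntegrableOn.of_bound (e.measure_carrier_lt_top hd) (hg'.aestronglyMeasurable hm) C ?_
  filter_upwards [ae_restrict_mem hm] with x hx using hC x hx

variable {v : Space d → Space d}

lemma Mesh.Elem.sum_facetFlux [DecidableEq (Space d)] (hd : 1 ≤ d)
    (hΩ : interior (closure Ω) = Ω) (hv : IsIncompressibleVelocity Ω v) (K : 𝒯.Elem) :
    ∑ i : K.1, facetFlux v K.1 (K.1.erase i) = 0 := by
  have := K.nontrivial hd
  have h := sum_facet_flux_eq_zero K.basis (v := v)
    (by rw [← K.carrier_eq]; exact hv.continuousOn.mono K.carrier_subset)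
    (by
      intro φ hφ hφc hsupp
      rw [← K.carrier_eq] at hsupp ⊢
      have hsub : interior K.carrier ⊆ Ω := by
        have := interior_mono K.carrier_subset
        rwa [hΩ] at this
      -- The integrand lives on the support of `φ`, inside `K`, so integrating over `K` or over `Ω`
      -- gives the same value.
      have hz : ∀ x, x ∉ tsupport φ → ⟪v x, ∇ φ x⟫ = 0 := by
        intro x hx
        have : fderiv ℝ φ x = 0 := by
          by_contra hne
          exact hx (support_fderiv_subset ℝ hne)
        rw [gradient, this, map_zero, inner_zero_right]
      rw [setIntegral_eq_integral_of_forall_compl_eq_zero fun x hx =>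
        hz x fun h => hx (interior_subset (hsupp h)),
        ← setIntegral_eq_integral_of_forall_compl_eq_zero (s := Ω) fun x hx =>
          hz x fun h => hx (hsub (hsupp h))]
      exact hv.divFree φ hφ hφc (hsupp.trans hsub))
  rw [← h]
  refine Finset.sum_congr rfl fun i _ => ?_
  rw [facetFlux, outerNormal_erase K.basis K.coe_basis hd K.2.2 i,
    convexHull_erase K.basis K.coe_basis]

/-- Almost every point of such a facet is a flat boundary point with this outward normal, so the
slip condition applies there. -/
lemma Mesh.Elem.facetFlux_eq_zero [DecidableEq (Space d)] (hd : 1 ≤ d)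
    (hΩ : interior (closure Ω) = Ω) (hv : IsIncompressibleVelocity Ω v) (K : 𝒯.Elem) (i : K.1)
    (hi : ∀ L : 𝒯.Elem, K.1.erase i ⊆ L.1 → L = K) :
    facetFlux v K.1 (K.1.erase i) = 0 := by
  have := K.nontrivial hd
  rw [facetFlux, convexHull_erase K.basis K.coe_basis]
  refine integral_eq_zero_of_ae ?_
  filter_upwards [ae_facet K.basis i] with x hx
  exact hv.slip x _ (K.isOutwardNormalAt hd hΩ i hi hx.1 hx.2)

/-- The total flux through the interior edges of an element vanishes. -/
lemma Mesh.Elem.sum_intEdge_facetFlux [DecidableEq (Space d)] (hd : 1 ≤ d)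
    (hΩ : interior (closure Ω) = Ω) (hv : IsIncompressibleVelocity Ω v) (K : 𝒯.Elem) :
    ∑ e : 𝒯.IntEdge, (if e.1 ⊆ K.1 then facetFlux v K.1 e.1 else 0) = 0 := by
  rw [← Finset.sum_filter, ← K.sum_facetFlux hd hΩ hv]
  have h1 : ∑ e ∈ Finset.univ.filter (fun e : 𝒯.IntEdge => e.1 ⊆ K.1), facetFlux v K.1 e.1 =
      ∑ s ∈ (Finset.univ.filter (fun e : 𝒯.IntEdge => e.1 ⊆ K.1)).image (fun e => e.1),
        facetFlux v K.1 s :=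
    (Finset.sum_image fun e _ e' _ h => Subtype.ext h).symm
  have h2 : ∑ i : K.1, facetFlux v K.1 (K.1.erase i) =
      ∑ s ∈ Finset.univ.image (fun i : K.1 => K.1.erase i), facetFlux v K.1 s := by
    refine (Finset.sum_image fun i _ j _ h => Subtype.ext ?_).symm
    by_contra hij
    have : (i : Space d) ∈ K.1.erase (j : Space d) := Finset.mem_erase.2 ⟨hij, i.2⟩
    rw [← h] at this
    exact Finset.notMem_erase _ _ this
  rw [h1, h2]
  -- The interior edges of `K` are among its facets, and a facet left out is contained in no other
  -- element.
  refine Finset.sum_subset (fun s hs => ?_) fun s hs hs' => ?_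
  · obtain ⟨e, he, rfl⟩ := Finset.mem_image.1 hs
    obtain ⟨i, hi⟩ := exists_eq_erase (Finset.mem_filter.1 he).2 K.2.2 e.2.2.1
    exact Finset.mem_image.2 ⟨i, Finset.mem_univ _, hi.symm⟩
  · obtain ⟨i, -, rfl⟩ := Finset.mem_image.1 hs
    refine K.facetFlux_eq_zero hd hΩ hv i fun L hL => ?_
    by_contra hne
    have hcard : (K.1.erase (i : Space d)).card = d := by
      rw [Finset.card_erase_of_mem i.2, K.2.2, Nat.add_sub_cancel]
    have hface : K.1.erase (i : Space d) ∈ 𝒯.complex.faces :=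
      𝒯.complex.down_closed K.2.1 (Finset.erase_subset _ _)
        (by rw [← Finset.card_pos, hcard]; exact hd)
    refine hs' (Finset.mem_image.2 ⟨⟨_, hface, hcard, K, L, Ne.symm hne,
      Finset.erase_subset _ _, hL⟩, ?_, rfl⟩)
    exact Finset.mem_filter.2 ⟨Finset.mem_univ _, Finset.erase_subset _ _⟩

/-- The indicator function of an element. -/
noncomputable def Mesh.Elem.indicator (K : 𝒯.Elem) : 𝒯.P0disc :=
  open Classical in fun L => if L = K then 1 else 0

lemma Mesh.Elem.indicator_self (K : 𝒯.Elem) : K.indicator K = 1 := if_pos rfl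

lemma Mesh.Elem.indicator_of_ne {K L : 𝒯.Elem} (h : L ≠ K) : K.indicator L = 0 := if_neg h

/-- The jump of the indicator is `1` when `K` is on the left and `-1` when it is on the right. This
sign turns `n_e` into the outer normal of `K`, so the sum is the outward flux whatever the
orientation. -/
lemma sum_edgeIntegral_eq_zero (hd : 1 ≤ d) (hΩ : interior (closure Ω) = Ω)
    (hv : IsIncompressibleVelocity Ω v) (o : 𝒯.Orientation) (K : 𝒯.Elem) :
    ∑ e, Mesh.edgeIntegral e (fun x => ⟪v x, o.normal e⟫ *
      (K.indicator (o.left e) - K.indicator (o.right e))) = 0 := by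
  classical
  rw [← K.sum_intEdge_facetFlux hd hΩ hv]
  refine Finset.sum_congr rfl fun e _ => ?_
  rw [Mesh.edgeIntegral, integral_mul_const]
  by_cases hl : o.left e = K
  · have hr : o.right e ≠ K := fun h => o.ne e (hl.trans h.symm)
    rw [if_pos (hl ▸ o.subset_left e), Mesh.Elem.indicator_of_ne hr, hl,
      Mesh.Elem.indicator_self, sub_zero, mul_one, facetFlux, Mesh.Orientation.normal, hl]
    rfl
  · by_cases hr : o.right e = K
    · rw [if_pos (hr ▸ o.subset_right e), Mesh.Elem.indicator_of_ne hl, hr,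
        Mesh.Elem.indicator_self, zero_sub, mul_neg, mul_one, facetFlux, ← integral_neg, ← hr,
        Mesh.Elem.outerNormal_eq_neg hd (o.ne e) e.2.2.1 (o.subset_left e) (o.subset_right e)]
      simp only [inner_neg_right]
      rfl
    · rw [if_neg, Mesh.Elem.indicator_of_ne hl, Mesh.Elem.indicator_of_ne hr, sub_zero, mul_zero]
      intro he
      rcases o.eq_left_or_eq_right hd e he with h | h
      · exact hl h.symm
      · exact hr h.symm

/-! ### Signs of the upwind forms -/

lemma posPart_nonneg (a : ℝ) : 0 ≤ posPart a := le_max_right _ _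

lemma negPart_nonneg (a : ℝ) : 0 ≤ negPart a := neg_nonneg.2 (min_le_right _ _)

lemma posPart_sub_negPart (a : ℝ) : posPart a - negPart a = a := by
  rw [posPart, negPart, sub_neg_eq_add, max_add_min, add_zero]

/-- Upwinding takes the neighbour's value exactly on inflow. Since that value is at least `u K`,
each integrand is at most `u K` times the outward normal velocity, and the total flux is zero. -/
lemma upwLinear_nonpos (hd : 1 ≤ d) (hΩ : interior (closure Ω) = Ω)
    (hv : IsIncompressibleVelocity Ω v) (o : 𝒯.Orientation) {u : 𝒯.P0disc} {K : 𝒯.Elem}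
    (hK : ∀ L, u K ≤ u L) : upwLinear o v u K.indicator ≤ 0 := by
  have h0 : u K * ∑ e, Mesh.edgeIntegral e (fun x => ⟪v x, o.normal e⟫ *
      (K.indicator (o.left e) - K.indicator (o.right e))) = 0 := by
    rw [sum_edgeIntegral_eq_zero hd hΩ hv, mul_zero]
  rw [← h0, Finset.mul_sum]
  refine Finset.sum_le_sum fun e _ => ?_
  rw [Mesh.edgeIntegral, Mesh.edgeIntegral, ← integral_const_mul]
  have hb : ContinuousOn (fun x => ⟪v x, o.normal e⟫) (closure Ω) :=
    hv.continuousOn.inner continuousOn_const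
  refine setIntegral_mono_on (e.integrableOn hd ?_) (e.integrableOn hd ?_)
    e.isCompact_carrier.isClosed.measurableSet fun x _ => ?_
  · have hp : ContinuousOn (fun x => posPart ⟪v x, o.normal e⟫) (closure Ω) :=
      hb.sup continuousOn_const
    have hn : ContinuousOn (fun x => negPart ⟪v x, o.normal e⟫) (closure Ω) :=
      (hb.inf continuousOn_const).neg
    exact ((hp.mul continuousOn_const).sub (hn.mul continuousOn_const)).mul continuousOn_const
  · exact continuousOn_const.mul (hb.mul continuousOn_const)
  · have h1 := posPart_sub_negPart ⟪v x, o.normal e⟫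
    have h2 := posPart_nonneg ⟪v x, o.normal e⟫
    have h3 := negPart_nonneg ⟪v x, o.normal e⟫
    have h5 : u K * ⟪v x, o.normal e⟫ =
        u K * (posPart ⟪v x, o.normal e⟫ - negPart ⟪v x, o.normal e⟫) := by rw [h1]
    by_cases hl : o.left e = K
    · have hr : o.right e ≠ K := fun h => o.ne e (hl.trans h.symm)
      simp only [hl, Mesh.Elem.indicator_self, Mesh.Elem.indicator_of_ne hr]
      nlinarith [mul_le_mul_of_nonneg_left (hK (o.right e)) h3, h5]
    · by_cases hr : o.right e = K
      · simp only [hr, Mesh.Elem.indicator_self, Mesh.Elem.indicator_of_ne hl]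
        nlinarith [mul_le_mul_of_nonneg_left (hK (o.left e)) h2, h5]
      · simp [Mesh.Elem.indicator_of_ne hl, Mesh.Elem.indicator_of_ne hr]

lemma upwLinear_neg (o : 𝒯.Orientation) (v : Space d → Space d) (u ub : 𝒯.P0disc) :
    upwLinear o v (-u) ub = -upwLinear o v u ub := by
  rw [upwLinear, upwLinear, ← Finset.sum_neg_distrib]
  refine Finset.sum_congr rfl fun e _ => ?_
  rw [Mesh.edgeIntegral, Mesh.edgeIntegral, ← integral_neg]
  refine integral_congr_ae (Eventually.of_forall fun x => ?_)
  simp only [Pi.neg_apply]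
  ring

lemma upwLinear_nonneg (hd : 1 ≤ d) (hΩ : interior (closure Ω) = Ω)
    (hv : IsIncompressibleVelocity Ω v) (o : 𝒯.Orientation) {u : 𝒯.P0disc} {K : 𝒯.Elem}
    (hK : ∀ L, u L ≤ u K) : 0 ≤ upwLinear o v u K.indicator := by
  have h := upwLinear_nonpos hd hΩ hv o (u := -u) (K := K) fun L => neg_le_neg (hK L)
  rwa [upwLinear_neg, neg_nonpos] at h

/-! ### Bounds on the monotone parts of the mobility -/

lemma posPart_mobility_le (s : ℝ) : posPart (mobility s) ≤ mobility (1 / 2) := by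
  refine max_le ?_ (by norm_num [mobility])
  rw [mobility, mobility]
  nlinarith [sq_nonneg (s - 1 / 2)]

lemma mobilityUp_nonneg (s : ℝ) : 0 ≤ mobilityUp s := by
  rw [mobilityUp]
  split_ifs
  · exact posPart_nonneg _
  · norm_num [mobility]

lemma mobilityUp_le (s : ℝ) : mobilityUp s ≤ mobility (1 / 2) := by
  rw [mobilityUp]
  split_ifs
  · exact posPart_mobility_le s
  · exact le_rfl

lemma mobilityDown_nonpos (s : ℝ) : mobilityDown s ≤ 0 := by
  rw [mobilityDown]
  split_ifs
  · exact le_rfl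
  · exact sub_nonpos.2 (posPart_mobility_le s)

lemma le_mobilityDown (s : ℝ) : -mobility (1 / 2) ≤ mobilityDown s := by
  rw [mobilityDown]
  split_ifs
  · norm_num [mobility]
  · linarith [posPart_nonneg (mobility s)]

lemma mobilityUp_of_nonpos {s : ℝ} (hs : s ≤ 0) : mobilityUp s = 0 := by
  rw [mobilityUp, if_pos (by linarith), posPart, max_eq_right]
  rw [mobility]
  nlinarith

lemma mobilityDown_of_nonpos {s : ℝ} (hs : s ≤ 0) : mobilityDown s = 0 :=
  if_pos (by linarith)

lemma mobilityUp_of_one_le {s : ℝ} (hs : 1 ≤ s) : mobilityUp s = mobility (1 / 2) :=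
  if_neg (by linarith)

lemma mobilityDown_of_one_le {s : ℝ} (hs : 1 ≤ s) : mobilityDown s = -mobility (1 / 2) := by
  rw [mobilityDown, if_neg (by linarith), posPart, max_eq_right, zero_sub]
  rw [mobility]
  nlinarith

lemma upwMobility_eq (o : 𝒯.Orientation) (β : 𝒯.Elem → Space d → Space d) (u ub : 𝒯.P0disc) :
    upwMobility o β u ub = ∑ e, Mesh.edgeIntegral e fun x =>
      (posPart ⟪(1 / 2 : ℝ) • (β (o.left e) x + β (o.right e) x), o.normal e⟫ *
          (mobilityUp (u (o.left e)) + mobilityDown (u (o.right e)))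
        - negPart ⟪(1 / 2 : ℝ) • (β (o.left e) x + β (o.right e) x), o.normal e⟫ *
          (mobilityUp (u (o.right e)) + mobilityDown (u (o.left e)))) *
        (ub (o.left e) - ub (o.right e)) := by
  have h : ∀ (K : 𝒯.Elem) (x : Space d), ∇ (ub.broken K) x = 0 := by
    intro K x
    have : ub.broken K = fun _ => ub K := rfl
    rw [gradient, this, fderiv_const_apply, map_zero]
  simp [upwMobility, h]

/-- At `u K ≤ 0` only the neighbours' parts remain: `M↓ ≤ 0` multiplies the outflow and `M↑ ≥ 0` the
inflow. The sign is pointwise, whatever the field `β`. -/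
lemma upwMobility_nonpos (o : 𝒯.Orientation) (β : 𝒯.Elem → Space d → Space d) {u : 𝒯.P0disc}
    {K : 𝒯.Elem} (hK : u K ≤ 0) : upwMobility o β u K.indicator ≤ 0 := by
  rw [upwMobility_eq]
  refine Finset.sum_nonpos fun e _ => integral_nonpos fun x => ?_
  have h2 := posPart_nonneg ⟪(1 / 2 : ℝ) • (β (o.left e) x + β (o.right e) x), o.normal e⟫
  have h3 := negPart_nonneg ⟪(1 / 2 : ℝ) • (β (o.left e) x + β (o.right e) x), o.normal e⟫
  generalize posPart ⟪(1 / 2 : ℝ) • (β (o.left e) x + β (o.right e) x), o.normal e⟫ = p at *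
  generalize negPart ⟪(1 / 2 : ℝ) • (β (o.left e) x + β (o.right e) x), o.normal e⟫ = q at *
  by_cases hl : o.left e = K
  · have hr : o.right e ≠ K := fun h => o.ne e (hl.trans h.symm)
    simp only [hl, Mesh.Elem.indicator_self, Mesh.Elem.indicator_of_ne hr, mobilityUp_of_nonpos hK,
      mobilityDown_of_nonpos hK, Pi.zero_apply]
    nlinarith [mul_nonneg h3 (mobilityUp_nonneg (u (o.right e))),
      mul_nonneg h2 (neg_nonneg.2 (mobilityDown_nonpos (u (o.right e))))]
  · by_cases hr : o.right e = K
    · simp only [hr, Mesh.Elem.indicator_self, Mesh.Elem.indicator_of_ne hl,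
        mobilityUp_of_nonpos hK, mobilityDown_of_nonpos hK, Pi.zero_apply]
      nlinarith [mul_nonneg h2 (mobilityUp_nonneg (u (o.left e))),
        mul_nonneg h3 (neg_nonneg.2 (mobilityDown_nonpos (u (o.left e))))]
    · simp [Mesh.Elem.indicator_of_ne hl, Mesh.Elem.indicator_of_ne hr]

/-- At `1 ≤ u K` the parts of `K` are `M(1/2)` and `-M(1/2)`, the extreme values of `M↑` and `M↓`.
The outflow coefficient `M(1/2) + M↓` is then nonnegative and the inflow coefficient `M↑ - M(1/2)`
nonpositive. -/
lemma upwMobility_nonneg (o : 𝒯.Orientation) (β : 𝒯.Elem → Space d → Space d) {u : 𝒯.P0disc}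
    {K : 𝒯.Elem} (hK : 1 ≤ u K) : 0 ≤ upwMobility o β u K.indicator := by
  rw [upwMobility_eq]
  refine Finset.sum_nonneg fun e _ => integral_nonneg fun x => ?_
  have h2 := posPart_nonneg ⟪(1 / 2 : ℝ) • (β (o.left e) x + β (o.right e) x), o.normal e⟫
  have h3 := negPart_nonneg ⟪(1 / 2 : ℝ) • (β (o.left e) x + β (o.right e) x), o.normal e⟫
  generalize posPart ⟪(1 / 2 : ℝ) • (β (o.left e) x + β (o.right e) x), o.normal e⟫ = p at *
  generalize negPart ⟪(1 / 2 : ℝ) • (β (o.left e) x + β (o.right e) x), o.normal e⟫ = q at *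
  by_cases hl : o.left e = K
  · have hr : o.right e ≠ K := fun h => o.ne e (hl.trans h.symm)
    simp only [hl, Mesh.Elem.indicator_self, Mesh.Elem.indicator_of_ne hr, mobilityUp_of_one_le hK,
      mobilityDown_of_one_le hK, Pi.zero_apply]
    nlinarith [mul_nonneg h3 (sub_nonneg.2 (mobilityUp_le (u (o.right e)))),
      mul_nonneg h2 (sub_nonneg.2 (le_mobilityDown (u (o.right e))))]
  · by_cases hr : o.right e = K
    · simp only [hr, Mesh.Elem.indicator_self, Mesh.Elem.indicator_of_ne hl,
        mobilityUp_of_one_le hK, mobilityDown_of_one_le hK, Pi.zero_apply]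
      nlinarith [mul_nonneg h2 (sub_nonneg.2 (mobilityUp_le (u (o.left e)))),
        mul_nonneg h3 (sub_nonneg.2 (le_mobilityDown (u (o.left e))))]
    · simp [Mesh.Elem.indicator_of_ne hl, Mesh.Elem.indicator_of_ne hr]

lemma inner₂_indicator (c : 𝒯.P0disc) (K : 𝒯.Elem) :
    𝒯.inner₂ (fun L _ => c L) K.indicator.broken = volume.real K.carrier * c K := by
  rw [Mesh.inner₂, Finset.sum_eq_single K]
  · simp [Mesh.P0disc.broken, Mesh.Elem.indicator_self]
  · intro L _ hL
    simp [Mesh.P0disc.broken, Mesh.Elem.indicator_of_ne hL]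
  · exact fun h => (h (Finset.mem_univ K)).elim

end ElementFlux

end DGUPW

/-! ### The maximum principle -/

theorem mainTheorem1 {d : ℕ} (hd : 1 ≤ d) {Ω : Set (DGUPW.Space d)}
    (hΩ : DGUPW.IsPolygonalDomain Ω) (𝒯 : DGUPW.Mesh Ω) (o : 𝒯.Orientation)
    {ε T : ℝ} (hε : 0 < ε) (hT : 0 < T) {N : ℕ}
    (v : ℝ → DGUPW.Space d → DGUPW.Space d)
    (hv : ∀ t ∈ Set.Ioc 0 T, DGUPW.IsIncompressibleVelocity Ω (v t))
    (m : ℕ) (hm : m < N)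
    (u₀ : 𝒯.P0disc) (hu₀ : ∀ K, 0 ≤ u₀ K ∧ u₀ K ≤ 1)
    (u : 𝒯.P0disc) (μ w : 𝒯.P1cont)
    (hsol : DGUPW.IsSolution o ε (T / N) (v ((m + 1) * (T / N))) u₀ u μ w) :
    ∀ K, 0 ≤ u K ∧ u K ≤ 1 := by
  have hN : (0 : ℝ) < N := by exact_mod_cast (Nat.zero_le m).trans_lt hm
  have hΔ : 0 < T / N := div_pos hT hN
  have hmN : (m : ℝ) + 1 ≤ N := by exact_mod_cast hm
  -- The new time `t_{m+1}` lies in `(0, T]` because `m + 1 ≤ N`.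
  have hv' := hv ((m + 1) * (T / N)) ⟨by positivity, by
    calc ((m : ℝ) + 1) * (T / N) ≤ N * (T / N) := mul_le_mul_of_nonneg_right hmN hΔ.le
      _ = T := by field_simp⟩
  have hphase := fun K : 𝒯.Elem => hsol.phase K.indicator
  simp only [DGUPW.inner₂_indicator (fun K => (u K - u₀ K) / (T / N))] at hphase
  intro K
  have : Nonempty 𝒯.Elem := ⟨K⟩
  constructor
  · obtain ⟨L, hL⟩ := Finite.exists_min u
    refine le_trans ?_ (hL K)
    -- At a negative minimum all three terms of the tested phase equation are nonpositive, and the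
    -- time term strictly so.
    by_contra! hneg
    have h1 := DGUPW.upwLinear_nonpos hd hΩ.interior_closure hv' o hL
    have h2 := DGUPW.upwMobility_nonpos o (fun K x => -(μ.grad K x)) hneg.le
    have h4 : MeasureTheory.volume.real L.carrier * ((u L - u₀ L) / (T / N)) < 0 :=
      mul_neg_of_pos_of_neg L.volume_pos
        (div_neg_of_neg_of_pos (by linarith [(hu₀ L).1]) hΔ)
    linarith [hphase L]
  · obtain ⟨L, hL⟩ := Finite.exists_max u
    refine (hL K).trans ?_
    by_contra! hgt
    have h1 := DGUPW.upwLinear_nonneg hd hΩ.interior_closure hv' o hL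
    have h2 := DGUPW.upwMobility_nonneg o (fun K x => -(μ.grad K x)) hgt.le
    have h4 : 0 < MeasureTheory.volume.real L.carrier * ((u L - u₀ L) / (T / N)) :=
      mul_pos L.volume_pos (div_pos (by linarith [(hu₀ L).2]) hΔ)
    linarith [hphase L]
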